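/- Let $k$ be a field. A \emph{gentle quiver with relations} $\overline{Q}=(Q,R)$ consists of a quiver $Q$ with finitely many vertices, with at most two arrows leaving and at most two arrows arriving at each vertex, and a set $R$ of paths of length $2$ in $Q$ such that for every arrow $\beta$ there is at most one arrow $\gamma$ with $\beta\gamma$ a path in $R$, at most one arrow $\gamma$ with $\beta\gamma$ a path not in $R$, at most one arrow $\alpha$ with $\alpha\beta$ a path in $R$, and at most one arrow $\alpha$ with $\alpha\beta$ a path not in $R$, and such that all sufficiently long paths of $Q$ contain a subpath in $R$. Its algebra $\Lambda=kQ/\langle R\rangle$ is then finite-dimensional; write $e_i\in\Lambda$ for the idempotent of the vertex $i$. For a ring $A$, let $K^b(\operatorname{proj}A)$ be the bounded homotopy category of finitely generated projective right $A$-modules. A $2$-term object is a complex $P_1\to P_0$ concentrated in homological degrees $1$ and $0$; an object $P$ is rigid if $\operatorname{Hom}_{K^b(\operatorname{proj}A)}(P,P[1])=0$. The $2$-term silting complex $\mathcal{SC}(A)$ is the simplicial complex whose vertices are the isomorphism classes of indecomposable rigid $2$-term objects of $K^b(\operatorname{proj}A)$ and whose faces are the finite sets of such objects whose direct sum is rigid.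 The $\mathbf g$-vector of a $2$-term object is its class in the Grothendieck group $K_0(K^b(\operatorname{proj}A))$. For a quiver with relations, $\mathcal{SC}(\overline{Q}):=\mathcal{SC}(kQ/\langle R\rangle)$. Let $\overline{Q}=(Q,R)$ be a gentle quiver with relations and let $J$ be any subset of its vertices. The \emph{shortcut quiver} $\overline{Q}_J=(Q_J,R_J)$ has the elements of $J$ as vertices; its arrows from $i$ to $j$ are the paths of positive length from $i$ to $j$ in $Q$ which contain no subpath in $R$ and have no interior vertex in $J$; the composition of two consecutive arrows of $Q_J$ is in $R_J$ if and only if the corresponding concatenated path of $Q$ contains a subpath in $R$. \textbf{Theorem.} For every gentle quiver with relations $\overline{Q}$ and every subset $J$ of its vertices, the simplicial complex $\mathcal{SC}(\overline{Q}_J)$ is isomorphic to the subcomplex of $\mathcal{SC}(\overline{Q})$ induced by those vertices (isomorphism classes of indecomposable rigid $2$-term objects) whose $\mathbf g$-vectors lie in the coordinate subspace of $K_0(K^b(\operatorname{proj}\Lambda))$ spanned by the classes of the modules $e_j\Lambda$, $j\in J$, concentrated in degree $0$. -/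

import Mathlib

universe u

noncomputable section

namespace GentleSilting

open CategoryTheory CategoryTheory.Limits CategoryTheory.Pretriangulated ZeroObject

/-! ### Quivers with quadratic monomial relations and their algebras -/

section Quivers

variable {V : Type u} [Quiver.{u} V]

/-- A set of paths of length two in the quiver `V`, given by the pairs `(a, b)` of composable arrows
(first `a`, then `b`) whose composition is a relation. -/
abbrev QuadraticRelations (V : Type u) [Quiver.{u} V] : Type u :=
  ∀ ⦃i j l : V⦄, (i ⟶ j) → (j ⟶ l) → Prop

/-- The path `p` contains no relation as a subpath, i.e. `p` is nonzero in the bound path algebra: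
it is a path of the quiver with relations. -/
def AvoidsRelations (R : QuadraticRelations V) {i j : V} (p : Quiver.Path i j) : Prop :=
  ∀ ⦃x y z : V⦄ (p₁ : Quiver.Path i x) (a : x ⟶ y) (b : y ⟶ z) (p₂ : Quiver.Path z j),
    p = ((p₁.cons a).cons b).comp p₂ → ¬ R a b

/-- Gentle quivers with relations (on a finite set of vertices). -/
structure IsGentle (R : QuadraticRelations V) : Prop where
  /-- at most two arrows leave each vertex -/
  card_out_le : ∀ i : V, ENat.card (Σ j : V, i ⟶ j) ≤ 2
  /-- at most two arrows arrive at each vertex -/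
  card_in_le : ∀ j : V, ENat.card (Σ i : V, i ⟶ j) ≤ 2
  /-- for each arrow `a` there is at most one arrow `b` such that `ab` is a relation -/
  rel_right : ∀ ⦃i j : V⦄ (a : i ⟶ j), {b : Σ l : V, j ⟶ l | R a b.2}.Subsingleton
  /-- for each arrow `a` there is at most one arrow `b` such that `ab` is a path but no relation -/
  not_rel_right : ∀ ⦃i j : V⦄ (a : i ⟶ j), {b : Σ l : V, j ⟶ l | ¬ R a b.2}.Subsingleton
  /-- for each arrow `b` there is at most one arrow `a` such that `ab` is a relation -/
  rel_left : ∀ ⦃j l : V⦄ (b : j ⟶ l), {a : Σ i : V, i ⟶ j | R a.2 b}.Subsingleton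
  /-- for each arrow `b` there is at most one arrow `a` such that `ab` is a path but no relation -/
  not_rel_left : ∀ ⦃j l : V⦄ (b : j ⟶ l), {a : Σ i : V, i ⟶ j | ¬ R a.2 b}.Subsingleton
  /-- all long enough paths contain a relation, i.e. the bound path algebra is
  finite-dimensional -/
  admissible : ∃ N : ℕ, ∀ ⦃i j : V⦄ (p : Quiver.Path i j), AvoidsRelations R p → p.length < N

/-- No vertex of the path `p`, except possibly its two ends, lies in `J`. -/
def NoInteriorVertexIn (J : Finset V) {i j : V} (p : Quiver.Path i j) : Prop :=
  ∀ ⦃x : V⦄ (p₁ : Quiver.Path i x) (p₂ : Quiver.Path x j),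
    p = p₁.comp p₂ → 0 < p₁.length → 0 < p₂.length → x ∉ J

/-- The vertices of the shortcut quiver of `(V, R)` at `J`: the elements of `J`. -/
def Shortcut (_R : QuadraticRelations V) (J : Finset V) : Type u := {i : V // i ∈ J}

instance (R : QuadraticRelations V) (J : Finset V) : Fintype (Shortcut R J) :=
  inferInstanceAs (Fintype {i : V // i ∈ J})

instance [DecidableEq V] (R : QuadraticRelations V) (J : Finset V) : DecidableEq (Shortcut R J) :=
  inferInstanceAs (DecidableEq {i : V // i ∈ J})

/-- The arrows of the shortcut quiver are the paths of positive length in the quiver with relations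
`(V, R)` whose ends are in `J` and which have no interior vertex in `J`. -/
instance (R : QuadraticRelations V) (J : Finset V) : Quiver.{u} (Shortcut R J) where
  Hom i j := {p : Quiver.Path i.1 j.1 //
    0 < p.length ∧ AvoidsRelations R p ∧ NoInteriorVertexIn J p}

/-- The relations of the shortcut quiver are inherited from those of `(V, R)`: the composition of
two arrows is a relation if and only if the concatenated path contains a relation. -/
def shortcutRelations (R : QuadraticRelations V) (J : Finset V) :
    QuadraticRelations (Shortcut R J) :=
  fun _ _ _ p q => ¬ AvoidsRelations R (p.1.comp q.1)

end Quivers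

section PathAlgebra

variable (k : Type u) [Field k] (V : Type u) [Quiver.{u} V]

/-- The path algebra of a finite quiver: an element is a finite linear combination of paths, recorded
by its parts from `i` to `j` for all pairs of vertices `i`, `j`. -/
def PathAlgebra : Type u := ∀ i j : V, Quiver.Path i j →₀ k

instance : AddCommGroup (PathAlgebra k V) :=
  inferInstanceAs (AddCommGroup (∀ i j : V, Quiver.Path i j →₀ k))

variable {V}

/-- Bilinear extension of the concatenation of paths. -/
def concat (i l j : V) :
    (Quiver.Path i l →₀ k) →ₗ[k] (Quiver.Path l j →₀ k) →ₗ[k] (Quiver.Path i j →₀ k) :=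
  Finsupp.linearCombination k
    (fun p : Quiver.Path i l => Finsupp.lmapDomain k k (fun q : Quiver.Path l j => p.comp q))

lemma concat_single {i l j : V} (p : Quiver.Path i l) (q : Quiver.Path l j) (a b : k) :
    concat k i l j (Finsupp.single p a) (Finsupp.single q b) =
      Finsupp.single (p.comp q) (a * b) := by
  simp [concat, Finsupp.linearCombination_single]

lemma concat_assoc {i l m j : V} (f : Quiver.Path i l →₀ k) (g : Quiver.Path l m →₀ k)
    (h : Quiver.Path m j →₀ k) :
    concat k i m j (concat k i l m f g) h = concat k i l j f (concat k l m j g h) := by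
  induction f using Finsupp.induction_linear with
  | zero => simp
  | add f f' hf hf' => simp only [map_add, LinearMap.add_apply, hf, hf']
  | single p a =>
    induction g using Finsupp.induction_linear with
    | zero => simp
    | add g g' hg hg' => simp only [map_add, LinearMap.add_apply, hg, hg']
    | single q b =>
      induction h using Finsupp.induction_linear with
      | zero => simp
      | add h h' hh hh' => simp only [map_add, hh, hh']
      | single r c =>
        simp only [concat_single, mul_assoc, Quiver.Path.comp_assoc]

lemma concat_nil_left {i j : V} (f : Quiver.Path i j →₀ k) :
    concat k i i j (Finsupp.single Quiver.Path.nil 1) f = f := by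
  induction f using Finsupp.induction_linear with
  | zero => simp
  | add f g hf hg => simp only [map_add, hf, hg]
  | single p a => simp [concat_single]

lemma concat_nil_right {i j : V} (f : Quiver.Path i j →₀ k) :
    concat k i j j f (Finsupp.single Quiver.Path.nil 1) = f := by
  induction f using Finsupp.induction_linear with
  | zero => simp
  | add f g hf hg => simp only [map_add, LinearMap.add_apply, hf, hg]
  | single p a => simp [concat_single]

variable [DecidableEq V]

/-- A path, as an element of the path algebra. -/
def ofPath {i j : V} (p : Quiver.Path i j) : PathAlgebra k V :=
  Pi.single (M := fun i => ∀ j : V, Quiver.Path i j →₀ k) i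
    (Pi.single (M := fun j => Quiver.Path i j →₀ k) j (Finsupp.single p 1))

variable [Fintype V]

/-- The product of two paths is their concatenation (first the left factor, then the right factor)
if they can be concatenated and `0` otherwise; the unit is the sum of the paths of length `0`. -/
instance : Ring (PathAlgebra k V) where
  __ := (inferInstance : AddCommGroup (PathAlgebra k V))
  mul f g := fun i j => ∑ l : V, concat k i l j (f i l) (g l j)
  one := fun i => Pi.single (M := fun j => Quiver.Path i j →₀ k) i
    (Finsupp.single Quiver.Path.nil 1)
  left_distrib f g h := by
    funext i j
    change ∑ l : V, concat k i l j (f i l) (g l j + h l j) =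
      ∑ l : V, concat k i l j (f i l) (g l j) + ∑ l : V, concat k i l j (f i l) (h l j)
    simp only [map_add, Finset.sum_add_distrib]
  right_distrib f g h := by
    funext i j
    change ∑ l : V, concat k i l j (f i l + g i l) (h l j) =
      ∑ l : V, concat k i l j (f i l) (h l j) + ∑ l : V, concat k i l j (g i l) (h l j)
    simp only [map_add, LinearMap.add_apply, Finset.sum_add_distrib]
  zero_mul f := by
    funext i j
    change ∑ l : V, concat k i l j 0 (f l j) = 0
    simp
  mul_zero f := by
    funext i j
    change ∑ l : V, concat k i l j (f i l) 0 = 0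
    simp
  mul_assoc f g h := by
    funext i j
    change ∑ m : V, concat k i m j (∑ l : V, concat k i l m (f i l) (g l m)) (h m j) =
      ∑ l : V, concat k i l j (f i l) (∑ m : V, concat k l m j (g l m) (h m j))
    simp only [map_sum, LinearMap.sum_apply, concat_assoc]
    exact Finset.sum_comm
  one_mul f := by
    funext i j
    change ∑ l : V, concat k i l j (Pi.single (M := fun j => Quiver.Path i j →₀ k) i
      (Finsupp.single Quiver.Path.nil 1) l) (f l j) = f i j
    rw [Finset.sum_eq_single i]
    · rw [Pi.single_eq_same, concat_nil_left]
    · intro l _ hl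
      rw [Pi.single_eq_of_ne hl]
      simp
    · simp
  mul_one f := by
    funext i j
    change ∑ l : V, concat k i l j (f i l) (Pi.single (M := fun j => Quiver.Path l j →₀ k) l
      (Finsupp.single Quiver.Path.nil 1) j) = f i j
    rw [Finset.sum_eq_single j]
    · rw [Pi.single_eq_same, concat_nil_right]
    · intro l _ hl
      rw [Pi.single_eq_of_ne (Ne.symm hl)]
      simp
    · simp

lemma ofPath_nil_mul_self (i : V) :
    ofPath k (Quiver.Path.nil : Quiver.Path i i) * ofPath k (Quiver.Path.nil : Quiver.Path i i) =
      ofPath k (Quiver.Path.nil : Quiver.Path i i) := by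
  funext x y
  change ∑ l : V, concat k x l y (ofPath k (Quiver.Path.nil : Quiver.Path i i) x l)
    (ofPath k (Quiver.Path.nil : Quiver.Path i i) l y) =
      ofPath k (Quiver.Path.nil : Quiver.Path i i) x y
  by_cases hx : x = i
  · subst hx
    rw [Finset.sum_eq_single x]
    · simp only [ofPath, Pi.single_eq_same]
      rw [concat_nil_left]
    · intro l _ hl
      simp only [ofPath, Pi.single_eq_same, Pi.single_eq_of_ne hl]
      simp
    · simp
  · simp [ofPath, Pi.single_eq_of_ne hx]

/-- The two-sided ideal of the path algebra generated by the relations. -/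
def relationIdeal (R : QuadraticRelations V) : TwoSidedIdeal (PathAlgebra k V) :=
  TwoSidedIdeal.span
    {x | ∃ (i j l : V) (a : i ⟶ j) (b : j ⟶ l), R a b ∧ x = ofPath k (a.toPath.comp b.toPath)}

/-- The algebra of a quiver with relations: the quotient of its path algebra by the ideal generated
by the relations. -/
abbrev BoundAlgebra (R : QuadraticRelations V) : Type u :=
  (relationIdeal k R).ringCon.Quotient

/-- The idempotent of the vertex `i`. -/
def vertexIdempotent (R : QuadraticRelations V) (i : V) : BoundAlgebra k R :=
  (relationIdeal k R).ringCon.mk' (ofPath k (Quiver.Path.nil : Quiver.Path i i))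

lemma isIdempotentElem_vertexIdempotent (R : QuadraticRelations V) (i : V) :
    IsIdempotentElem (vertexIdempotent k R i) := by
  rw [IsIdempotentElem, vertexIdempotent, ← map_mul, ofPath_nil_mul_self]

end PathAlgebra

/-! ### Bounded homotopy categories and Grothendieck groups -/

section Bounded

variable (C : Type*) [Category* C] [Preadditive C]

/-- The bounded complexes. -/
def bounded : ObjectProperty (HomotopyCategory C (.up ℤ)) :=
  fun X => ∃ a b : ℤ, ∀ n : ℤ, (n < a ∨ b < n) → IsZero (X.as.X n)

variable [HasZeroObject C]

instance : (bounded C).ContainsZero where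
  exists_zero :=
    ⟨(HomotopyCategory.quotient _ _).obj 0, Functor.map_isZero _ (isZero_zero _),
      0, 0, fun n _ => (HomologicalComplex.eval C (.up ℤ) n).map_isZero (isZero_zero _)⟩

instance : (bounded C).IsStableUnderShift ℤ where
  isStableUnderShiftBy n :=
    { le_shift := by
        rintro K ⟨a, b, h⟩
        obtain ⟨K : CochainComplex _ _, rfl⟩ := K.quotient_obj_surjective
        rw [ObjectProperty.prop_shift_iff, HomotopyCategory.shift_quotient_obj]
        exact ⟨a - n, b - n, fun m hm => h (m + n) (by omega)⟩ }

variable [HasBinaryBiproducts C]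

set_option maxHeartbeats 400000 in
instance : (bounded C).IsTriangulatedClosed₃ where
  ext₃' T hT h₁ h₂ := by
    obtain ⟨a₁, b₁, h₁⟩ := h₁
    obtain ⟨a₂, b₂, h₂⟩ := h₂
    obtain ⟨f : T.obj₁.as ⟶ T.obj₂.as, hf⟩ :=
      (HomotopyCategory.quotient C (.up ℤ)).map_surjective T.mor₁
    refine ⟨(HomotopyCategory.quotient C (.up ℤ)).obj (CochainComplex.mappingCone f), ?_,
      ⟨Triangle.π₃.mapIso (isoTriangleOfIso₁₂ T _ hT
        (HomotopyCategory.mappingCone_triangleh_distinguished f)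
        (Iso.refl _) (Iso.refl _) ?_)⟩⟩
    · refine ⟨min (a₁ - 1) a₂, max b₁ b₂, fun n hn => ?_⟩
      exact (CochainComplex.mappingCone.isZero_X_iff f n).2
        ⟨h₁ (n + 1) (by omega), h₂ n (by omega)⟩
    · exact (Category.comp_id _).trans (hf.symm.trans (Category.id_comp _).symm)

instance : (bounded C).IsTriangulated where
  toIsTriangulatedClosed₂ := .of_isTriangulatedClosed₃

/-- The homotopy category of bounded complexes in an additive category. -/
abbrev BoundedHomotopyCategory := (bounded C).FullSubcategory

variable {C}

/-- An object of `C`, as a complex concentrated in degree `0`. -/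
def inDegreeZero (X : C) : BoundedHomotopyCategory C where
  obj := (HomotopyCategory.quotient C (.up ℤ)).obj ((HomologicalComplex.single C (.up ℤ) 0).obj X)
  property := ⟨0, 0, fun n hn =>
    HomologicalComplex.isZero_single_obj_X (.up ℤ) 0 X n (by omega)⟩

/-- The objects of the form `P₁ ⟶ P₀`. In cohomological numbering, `P₁` stands in degree `-1` and
`P₀` in degree `0`. -/
def IsTwoTerm (X : BoundedHomotopyCategory C) : Prop :=
  ∀ n : ℤ, n ≠ -1 → n ≠ 0 → IsZero (X.obj.as.X n)

end Bounded

section Triangulated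

variable (T : Type*) [Category* T] [Preadditive T] [HasZeroObject T] [HasShift T ℤ]
  [∀ n : ℤ, (shiftFunctor T n).Additive] [Pretriangulated T]

/-- The Grothendieck group of a triangulated category: generators are the objects, and each
distinguished triangle `X ⟶ Y ⟶ Z ⟶ X[1]` gives a relation `[Y] = [X] + [Z]`. -/
def K0 : Type _ :=
  FreeAbelianGroup T ⧸ AddSubgroup.closure
    {x : FreeAbelianGroup T | ∃ Δ ∈ distTriang T,
      x = FreeAbelianGroup.of Δ.obj₂ - (FreeAbelianGroup.of Δ.obj₁ + FreeAbelianGroup.of Δ.obj₃)}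

instance : AddCommGroup (K0 T) := inferInstanceAs (AddCommGroup (FreeAbelianGroup T ⧸ _))

variable {T}

/-- The class of an object in the Grothendieck group. -/
def K0.of (X : T) : K0 T := QuotientAddGroup.mk (FreeAbelianGroup.of X)

lemma K0.of_obj₂ (Δ : Triangle T) (h : Δ ∈ distTriang T) :
    K0.of Δ.obj₂ = K0.of Δ.obj₁ + K0.of Δ.obj₃ :=
  QuotientAddGroup.eq_iff_sub_mem.2 (AddSubgroup.subset_closure ⟨Δ, h, rfl⟩)

lemma K0.of_eq_of_iso {X Y : T} (e : X ≅ Y) : K0.of X = K0.of Y := by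
  have h₁ := K0.of_obj₂ _ (contractible_distinguished X)
  have h₂ := K0.of_obj₂ (Triangle.mk e.hom (0 : Y ⟶ 0) 0)
    (isomorphic_distinguished _ (contractible_distinguished X) _
      (Triangle.isoMk _ _ (Iso.refl X) e.symm (Iso.refl (0 : T))
        (e.hom_inv_id.trans (Category.comp_id _).symm) (zero_comp.trans comp_zero.symm)
        (zero_comp.trans comp_zero.symm)))
  exact h₁.trans h₂.symm

end Triangulated

section Rigid

variable {T : Type*} [Category* T] [Preadditive T] [HasShift T ℤ]

/-- `X` is rigid if there is no nonzero morphism `X ⟶ X[1]`. -/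
def IsRigid (X : T) : Prop := ∀ f : X ⟶ X⟦(1 : ℤ)⟧, f = 0

lemma IsRigid.of_retract {X Y : T} (h : Retract X Y) (hY : IsRigid Y) : IsRigid X := by
  intro f
  have h₁ := hY (h.r ≫ f ≫ h.i⟦(1 : ℤ)⟧')
  calc f = (h.i ≫ h.r) ≫ f ≫ (h.i ≫ h.r)⟦(1 : ℤ)⟧' := by simp
    _ = h.i ≫ (h.r ≫ f ≫ h.i⟦(1 : ℤ)⟧') ≫ h.r⟦(1 : ℤ)⟧' := by
      simp only [Functor.map_comp, Category.assoc]
    _ = 0 := by rw [h₁]; simp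

end Rigid

/-! ### The 2-term silting complex -/

section Silting

variable (A : Type u) [Ring A]

/-- The finitely generated projective right `A`-modules. -/
def finiteProjective : ObjectProperty (ModuleCat.{u} Aᵐᵒᵖ) :=
  fun M => Module.Finite Aᵐᵒᵖ M ∧ Module.Projective Aᵐᵒᵖ M

instance : (finiteProjective A).IsClosedUnderIsomorphisms where
  of_iso {M N} e h := by
    have := h.1
    have := h.2
    exact ⟨Module.Finite.equiv e.toLinearEquiv, Module.Projective.of_equiv e.toLinearEquiv⟩

instance : (finiteProjective A).ContainsZero where
  exists_zero := ⟨ModuleCat.of Aᵐᵒᵖ PUnit.{u + 1}, ModuleCat.isZero_of_subsingleton _,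
    inferInstanceAs (Module.Finite Aᵐᵒᵖ PUnit.{u + 1}),
    inferInstanceAs (Module.Projective Aᵐᵒᵖ PUnit.{u + 1})⟩

instance : (finiteProjective A).IsClosedUnderBinaryProducts :=
  .mk' (by
    rintro _ ⟨F, hF⟩
    obtain ⟨_, _⟩ := hF ⟨WalkingPair.left⟩
    obtain ⟨_, _⟩ := hF ⟨WalkingPair.right⟩
    refine (finiteProjective A).prop_of_iso
      ((HasLimit.isoOfNatIso (diagramIsoPair F)).trans (IsLimit.conePointUniqueUpToIso
        (limit.isLimit _) (ModuleCat.binaryProductLimitCone _ _).isLimit)).symm ?_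
    exact ⟨inferInstanceAs (Module.Finite Aᵐᵒᵖ (F.obj ⟨.left⟩ × F.obj ⟨.right⟩)),
      inferInstanceAs (Module.Projective Aᵐᵒᵖ (F.obj ⟨.left⟩ × F.obj ⟨.right⟩))⟩)

/-- The category of finitely generated projective right `A`-modules. -/
abbrev Proj : Type (u + 1) := (finiteProjective A).FullSubcategory

instance : HasBinaryProducts (Proj A) := inferInstance

instance : HasBinaryBiproducts (Proj A) := HasBinaryBiproducts.of_hasBinaryProducts

/-- The bounded homotopy category of finitely generated projective right `A`-modules. -/
abbrev KbProj : Type (u + 1) := BoundedHomotopyCategory (Proj A)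

variable {A}

/-- The projective right module `e A`, for an idempotent `e`. -/
def idempotentProj (e : A) (he : IsIdempotentElem e) : Proj A where
  obj := ModuleCat.of Aᵐᵒᵖ (Submodule.span Aᵐᵒᵖ {e})
  property := by
    have hmul : ∀ x ∈ Submodule.span Aᵐᵒᵖ {e}, e * x = x := by
      intro x hx
      obtain ⟨a, rfl⟩ := Submodule.mem_span_singleton.1 hx
      rw [mul_smul_comm, he.eq]
    refine ⟨inferInstanceAs (Module.Finite Aᵐᵒᵖ (Submodule.span Aᵐᵒᵖ {e})),
      Module.Projective.of_split (P := Submodule.span Aᵐᵒᵖ {e}) (M := Aᵐᵒᵖ)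
        { toFun := fun x => MulOpposite.op x.1
          map_add' := fun _ _ => rfl
          map_smul' := fun _ _ => rfl }
        (LinearMap.toSpanSingleton Aᵐᵒᵖ (Submodule.span Aᵐᵒᵖ {e})
          ⟨e, Submodule.mem_span_singleton_self e⟩) ?_⟩
    ext x
    exact hmul x.1 x.2

variable (A)

/-- The indecomposable rigid 2-term objects. -/
def IndecomposableRigid : Type (u + 1) :=
  {X : KbProj A // IsTwoTerm X ∧ IsRigid X ∧ Indecomposable X}

/-- Isomorphism in the bounded homotopy category. -/
instance indecomposableRigidSetoid : Setoid (IndecomposableRigid A) where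
  r X Y := Nonempty (X.1 ≅ Y.1)
  iseqv := ⟨fun _ => ⟨Iso.refl _⟩, fun ⟨e⟩ => ⟨e.symm⟩, fun ⟨e⟩ ⟨e'⟩ => ⟨e.trans e'⟩⟩

/-- The isomorphism classes of indecomposable rigid 2-term objects. -/
def SiltingVertex : Type (u + 1) := Quotient (indecomposableRigidSetoid A)

variable {A}

/-- An object in the given isomorphism class. -/
def SiltingVertex.rep (v : SiltingVertex A) : KbProj A := (Quotient.out v).1

lemma SiltingVertex.isRigid_rep (v : SiltingVertex A) : IsRigid v.rep := (Quotient.out v).2.2.1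

/-- The g-vector of an (isomorphism class of an) object: its class in the Grothendieck group of the
bounded homotopy category of projectives. -/
def SiltingVertex.gVector (v : SiltingVertex A) : K0 (KbProj A) :=
  Quotient.lift (s := indecomposableRigidSetoid A) (fun X : IndecomposableRigid A => K0.of X.1)
    (fun X Y (h : Nonempty (X.1 ≅ Y.1)) => h.elim K0.of_eq_of_iso) v

variable (A)

/-- The 2-term silting complex: its vertices are the isomorphism classes of indecomposable rigid
2-term objects, its faces are the (nonempty, finite) sets of such objects whose direct sum is
rigid. -/
def siltingComplex : AbstractSimplicialComplex (SiltingVertex A) where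
  faces := {s | s.Nonempty ∧ IsRigid (⨁ fun v : s => SiltingVertex.rep v.1)}
  isRelLowerSet_faces := by
    rintro s ⟨hs, h⟩
    refine ⟨hs, fun t hts ht => ⟨ht, ?_⟩⟩
    classical
    refine IsRigid.of_retract (Y := ⨁ fun v : s => SiltingVertex.rep v.1)
      ⟨biproduct.desc fun v => biproduct.ι (fun v : s => SiltingVertex.rep v.1) ⟨v.1, hts v.2⟩,
        biproduct.lift fun v => biproduct.π (fun v : s => SiltingVertex.rep v.1) ⟨v.1, hts v.2⟩,
        ?_⟩ h
    refine biproduct.hom_ext' _ _ fun v => biproduct.hom_ext _ _ fun w => ?_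
    simp [biproduct.ι_π]
  singleton_mem v := by
    refine ⟨Finset.singleton_nonempty v, ?_⟩
    refine IsRigid.of_retract (Y := v.rep)
      ⟨biproduct.desc fun w => eqToHom (by rw [Finset.mem_singleton.1 w.2]),
        biproduct.lift fun w => eqToHom (by rw [Finset.mem_singleton.1 w.2]), ?_⟩ v.isRigid_rep
    refine biproduct.hom_ext' _ _ fun w₁ => biproduct.hom_ext _ _ fun w₂ => ?_
    obtain rfl : w₁ = w₂ := Subsingleton.elim _ _
    simp

variable {A}

/-- The coordinate subspace (subgroup) of the Grothendieck group spanned by the classes of the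
projective modules `e j A`, concentrated in degree `0`, for `j` in `J`. -/
def coordinateSubspace {V : Type u} (e : V → A) (he : ∀ i, IsIdempotentElem (e i))
    (J : Finset V) : AddSubgroup (K0 (KbProj A)) :=
  AddSubgroup.closure {x | ∃ j ∈ J, x = K0.of (inDegreeZero (idempotentProj (e j) (he j)))}

end Silting

/-! ### Simplicial complexes -/

section SimplicialComplexes

variable {α β : Type*}

/-- The subcomplex of `K` induced by a set `S` of vertices: its faces are the faces of `K` all of
whose vertices are in `S`. -/
def inducedSubcomplex (K : AbstractSimplicialComplex α) (S : Set α) :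
    AbstractSimplicialComplex S where
  faces := {s | s.map (Function.Embedding.subtype _) ∈ K.faces}
  isRelLowerSet_faces := by
    intro s hs
    have h := K.isRelLowerSet_faces hs
    exact ⟨Finset.map_nonempty.1 h.1, fun t hts ht =>
      h.2 (Finset.map_subset_map.2 hts) (Finset.map_nonempty.2 ht)⟩
  singleton_mem v := by
    simpa using K.singleton_mem v.1

/-- Two simplicial complexes are isomorphic if there is a bijection between their vertices which
induces a bijection between their faces. -/
def AreIsomorphic (K : AbstractSimplicialComplex α) (L : AbstractSimplicialComplex β) : Prop :=
  ∃ φ : α ≃ β, ∀ s : Finset α, s ∈ K.faces ↔ s.map φ.toEmbedding ∈ L.faces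

end SimplicialComplexes

end GentleSilting

end

/-!
A path of `Q` between vertices of `J` that contains no relation factors uniquely, at its interior
vertices in `J`, as a path of `Q_J` that contains no relation. Hence the algebra of `Q_J` is the
corner `e Λ e` for `e = ∑ j ∈ J, e_j`, and `Hom(e Λ, -)` identifies the direct summands of finite
direct sums of copies of `e Λ` with the finitely generated projective modules over `e Λ e`. This
embeds `K^b(proj e Λ e)` into `K^b(proj Λ)` as a full subcategory closed under direct summands, so
that rigidity and indecomposability agree on both sides.

By Gaussian elimination every bounded complex is homotopy equivalent to a minimal one. The two terms
of a minimal rigid 2-term complex `d : P₁ ⟶ P₀` have no indecomposable summand in common, since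
every map `P₁ ⟶ P₀` is of the form `s d + d t` and thus vanishes on tops. There is then no
cancellation in the g-vector `[P₀] - [P₁]`, which lies in the coordinate subspace of `J` if and only
if both terms are supported on `J`.
-/

universe v

noncomputable section

namespace GentleSilting

open CategoryTheory CategoryTheory.Limits CategoryTheory.Pretriangulated ZeroObject

/-! ### Gaussian elimination and minimal complexes -/

section GaussianElimination

open CochainComplex.HomComplex

variable {C : Type*} [Category* C] [Preadditive C] [IsIdempotentComplete C]

lemma exists_iso_biprod_of_retract [HasBinaryBiproducts C] {X Y : C} (p : Retract Y X) :
    ∃ Z : C, Nonempty (X ≅ Y ⊞ Z) := by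
  obtain ⟨Z, i, r, hir, hri⟩ := IsIdempotentComplete.idempotents_split X (𝟙 X - p.r ≫ p.i)
    (by simp)
  have hi : i ≫ p.r = 0 := by
    calc i ≫ p.r = i ≫ (r ≫ i) ≫ p.r := by rw [Category.assoc, reassoc_of% hir]
      _ = 0 := by rw [hri]; simp
  have hr : p.i ≫ r = 0 := by
    calc p.i ≫ r = p.i ≫ (r ≫ i) ≫ r := by rw [Category.assoc, hir, Category.comp_id]
      _ = 0 := by rw [hri]; simp
  refine ⟨Z, ⟨⟨biprod.lift p.r r, biprod.desc p.i i, ?_, ?_⟩⟩⟩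
  · rw [biprod.lift_desc, hri, add_sub_cancel]
  · ext <;> simp [hi, hr, hir]

lemma exists_homotopyEquiv_of_idempotent {ι : Type*} {c : ComplexShape ι}
    {K : HomologicalComplex C c} {ε : K ⟶ K} (hε : ε ≫ ε = ε) (h : Homotopy ε 0) :
    ∃ (L : HomologicalComplex C c) (p : Retract L K),
      ε ≫ p.r = 0 ∧ Nonempty (HomotopyEquiv K L) := by
  obtain ⟨L, i, r, hir, hri⟩ := IsIdempotentComplete.idempotents_split K (𝟙 K - ε)
    (by simp [hε])
  refine ⟨L, ⟨i, r, hir⟩, ?_, ⟨⟨r, i, ?_, .ofEq hir⟩⟩⟩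
  · calc ε ≫ r = (ε ≫ r ≫ i) ≫ r := by simp [hir]
      _ = 0 := by rw [hri]; simp [hε]
  · exact (Homotopy.equivSubZero.symm (.trans (.ofEq (by rw [hri, sub_sub_cancel])) h)).symm

lemma exists_homotopyEquiv_of_retract_d {K : CochainComplex C ℤ} {P : C} {n : ℤ}
    (s : P ⟶ K.X n) (r : K.X (n + 1) ⟶ P) (hsr : s ≫ K.d n (n + 1) ≫ r = 𝟙 P) :
    ∃ (L : CochainComplex C ℤ) (p : Retract L K),
      s ≫ p.r.f n = 0 ∧ Nonempty (HomotopyEquiv K L) := by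
  let h : Cochain K K (-1) := Cochain.single (r ≫ s) (-1)
  let ε : K ⟶ K := Cocycle.homOf (Cocycle.mk (δ (-1) 0 h) 1 (by omega) (δ_δ _ _ _ _))
  have hε (l m p : ℤ) (hl : l + 1 = m) (hp : m + 1 = p) :
      ε.f m = h.v m l (by omega) ≫ K.d l m + K.d m p ≫ h.v p m (by omega) := by
    simp [ε, δ_v (-1) 0 (by omega) h m m (by omega) l p (by omega) hp]
  have hεn : ε.f n = K.d n (n + 1) ≫ r ≫ s := by
    rw [hε (n - 1) n _ (by omega) rfl, Cochain.single_v,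
      Cochain.single_v_eq_zero _ _ _ _ _ (by omega), zero_comp, zero_add]
  have hεn' : ε.f (n + 1) = r ≫ s ≫ K.d n (n + 1) := by
    rw [hε n _ _ rfl rfl, Cochain.single_v, Cochain.single_v_eq_zero _ _ _ _ _ (by omega),
      comp_zero, add_zero, Category.assoc]
  have hε₀ (m : ℤ) (h₁ : m ≠ n) (h₂ : m ≠ n + 1) : ε.f m = 0 := by
    rw [hε (m - 1) m _ (by omega) rfl, Cochain.single_v_eq_zero _ _ _ _ _ h₂,
      Cochain.single_v_eq_zero _ _ _ _ _ (by omega),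
      zero_comp, comp_zero, add_zero]
  have hidem : ε ≫ ε = ε := by
    ext m
    by_cases h₁ : m = n
    · subst h₁
      simp [hεn, reassoc_of% hsr]
    by_cases h₂ : m = n + 1
    · subst h₂
      simp [hεn', reassoc_of% hsr]
    · simp [hε₀ m h₁ h₂]
  obtain ⟨L, p, hp, e⟩ := exists_homotopyEquiv_of_idempotent hidem
    ((Cochain.equivHomotopy ε 0).symm ⟨h, by simp [ε]⟩)
  refine ⟨L, p, ?_, e⟩
  calc s ≫ p.r.f n = (s ≫ ε.f n) ≫ p.r.f n := by rw [hεn, reassoc_of% hsr]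
    _ = 0 := by rw [Category.assoc, ← HomologicalComplex.comp_f, hp]; simp

end GaussianElimination

/-- Objects `obj i` of an additive category `C`, to be thought of as representatives of the
indecomposable objects, together with additive functors `top i` which detect them as direct
summands: a morphism that is nonzero on `top i` restricts to an isomorphism between summands `obj i`
of its source and target. The example is the category of projective modules over a ring with
pairwise distinct one-dimensional simple modules `k_i`, where `obj i` is the projective cover of
`k_i` and `top i` is `M ↦ M ⊗ k_i`. -/
structure TopSystem (k : Type*) [Field k] (C : Type*) [Category* C] [Preadditive C]
    (ι : Type*) where
  obj : ι → C
  top : ι → C ⥤ ModuleCat.{v} k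
  additive (i : ι) : (top i).Additive
  finite (i : ι) (X : C) : Module.Finite k ((top i).obj X)
  isZero_top_obj {i j : ι} (hij : i ≠ j) : IsZero ((top i).obj (obj j))
  not_isZero_top_obj (i : ι) : ¬ IsZero ((top i).obj (obj i))
  exists_retract {i : ι} {X Y : C} (f : X ⟶ Y) (hf : (top i).map f ≠ 0) :
    ∃ (s : obj i ⟶ X) (r : Y ⟶ obj i), s ≫ f ≫ r = 𝟙 (obj i)
  isZero_of_isZero_top {X : C} (hX : ∀ i, IsZero ((top i).obj X)) : IsZero X

namespace TopSystem

attribute [instance] additive finite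

variable {k : Type*} [Field k] {C : Type*} [Category* C] [Preadditive C] {ι : Type*}
  (S : TopSystem.{v} k C ι)

/-- The objects all of whose indecomposable summands are among the `obj j` with `j ∈ J`. -/
def SupportedOn (J : Set ι) : ObjectProperty C :=
  fun X => ∀ i ∉ J, IsZero ((S.top i).obj X)

variable {J : Set ι}

instance : (S.SupportedOn J).IsStableUnderRetracts where
  of_retract p hY i hi := (hY i hi).of_mono (p.map (S.top i)).i

lemma supportedOn_obj {j : ι} (hj : j ∈ J) : S.SupportedOn J (S.obj j) :=
  fun _ hi => S.isZero_top_obj fun h => hi (h ▸ hj)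

lemma finrank_top_le_of_retract {X Y : C} (p : Retract X Y) (i : ι) :
    Module.finrank k ((S.top i).obj X) ≤ Module.finrank k ((S.top i).obj Y) :=
  LinearMap.finrank_le_finrank_of_injective (f := ((S.top i).map p.i).hom)
    ((ModuleCat.mono_iff_injective _).1 (inferInstanceAs (Mono (p.map (S.top i)).i)))

lemma finrank_top_lt_of_retract {i : ι} {X Y : C} (p : Retract X Y) (s : S.obj i ⟶ Y)
    [IsSplitMono s] (hs : s ≫ p.r = 0) :
    Module.finrank k ((S.top i).obj X) < Module.finrank k ((S.top i).obj Y) := by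
  refine (S.finrank_top_le_of_retract p i).lt_of_ne fun h => S.not_isZero_top_obj i ?_
  have hsurj : Function.Surjective ((S.top i).map p.r).hom :=
    (ModuleCat.epi_iff_surjective _).1 (inferInstanceAs (Epi (p.map (S.top i)).r))
  have : Mono ((S.top i).map p.r) := (ModuleCat.mono_iff_injective _).2
    ((LinearMap.injective_iff_surjective_of_finrank_eq_finrank h.symm).2 hsurj)
  refine IsZero.of_mono_eq_zero ((S.top i).map s) ?_
  rw [← cancel_mono ((S.top i).map p.r), ← Functor.map_comp, hs, Functor.map_zero, zero_comp]

section Length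

variable [Fintype ι]

/-- The number of indecomposable summands of `X`, where `obj i` is counted with multiplicity
`dim (top i (obj i))`. It serves as an induction parameter. -/
def length (X : C) : ℕ := ∑ i, Module.finrank k ((S.top i).obj X)

lemma length_le_of_retract {X Y : C} (p : Retract X Y) : S.length X ≤ S.length Y :=
  Finset.sum_le_sum fun i _ => S.finrank_top_le_of_retract p i

lemma length_lt_of_retract {i : ι} {X Y : C} (p : Retract X Y) (s : S.obj i ⟶ Y) [IsSplitMono s]
    (hs : s ≫ p.r = 0) : S.length X < S.length Y :=
  Finset.sum_lt_sum (fun j _ => S.finrank_top_le_of_retract p j)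
    ⟨i, Finset.mem_univ i, S.finrank_top_lt_of_retract p s hs⟩

end Length

variable {S}

theorem SupportedOn.induction [Finite ι] [HasBinaryBiproducts C] [IsIdempotentComplete C]
    {motive : C → Prop} (zero : ∀ X, IsZero X → motive X)
    (add : ∀ X Y j, j ∈ J → (X ≅ S.obj j ⊞ Y) → motive Y → motive X) {X : C}
    (hX : S.SupportedOn J X) : motive X := by
  cases nonempty_fintype ι
  induction h : S.length X using Nat.strong_induction_on generalizing X with
  | h n ih =>
    by_cases hX₀ : ∀ i, IsZero ((S.top i).obj X)
    · exact zero X (S.isZero_of_isZero_top hX₀)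
    push Not at hX₀
    obtain ⟨i, hi⟩ := hX₀
    have hi' : (S.top i).map (𝟙 X) ≠ 0 := by
      rwa [CategoryTheory.Functor.map_id, Ne, ← IsZero.iff_id_eq_zero]
    obtain ⟨s, r, hsr⟩ := S.exists_retract _ hi'
    obtain ⟨Y, ⟨e⟩⟩ := exists_iso_biprod_of_retract ⟨s, r, by simpa using hsr⟩
    let p : Retract Y X := ⟨biprod.inr ≫ e.inv, e.hom ≫ biprod.snd, by simp⟩
    refine add X Y i (by_contra fun hij => hi (hX i hij)) e
      (ih _ ?_ ((S.SupportedOn J).prop_of_retract p hX) rfl)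
    rw [← h]
    exact S.length_lt_of_retract p (biprod.inl ≫ e.inv) (by simp [p])

section Minimal

variable (S) in
/-- A complex is minimal if its differentials vanish on all tops, i.e. if no differential restricts
to an isomorphism between nonzero summands. -/
def IsMinimal (K : CochainComplex C ℤ) : Prop := ∀ i m n, (S.top i).map (K.d m n) = 0

lemma exists_retract_of_not_isMinimal {K : CochainComplex C ℤ} (hK : ¬ S.IsMinimal K) :
    ∃ (i : ι) (n : ℤ) (s : S.obj i ⟶ K.X n) (r : K.X (n + 1) ⟶ S.obj i),
      s ≫ K.d n (n + 1) ≫ r = 𝟙 (S.obj i) := by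
  simp only [IsMinimal, not_forall] at hK
  obtain ⟨i, n, m, h⟩ := hK
  obtain rfl : n + 1 = m := by
    by_contra hnm
    exact h (by rw [K.shape _ _ hnm, Functor.map_zero])
  exact ⟨i, n, S.exists_retract _ h⟩

variable (S) in
theorem exists_isMinimal [Finite ι] [IsIdempotentComplete C] (t : Finset ℤ)
    (K : CochainComplex C ℤ) (hK : ∀ n ∉ t, IsZero (K.X n)) :
    ∃ L : CochainComplex C ℤ,
      (∀ n ∉ t, IsZero (L.X n)) ∧ S.IsMinimal L ∧ Nonempty (HomotopyEquiv K L) := by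
  cases nonempty_fintype ι
  induction h : ∑ n ∈ t, S.length (K.X n) using Nat.strong_induction_on generalizing K with
  | h N ih =>
    by_cases hmin : S.IsMinimal K
    · exact ⟨K, hK, hmin, ⟨.refl K⟩⟩
    obtain ⟨i, n, s, r, hsr⟩ := exists_retract_of_not_isMinimal hmin
    obtain ⟨L, p, hsp, ⟨e⟩⟩ := exists_homotopyEquiv_of_retract_d s r hsr
    have : IsSplitMono s := ⟨⟨K.d n (n + 1) ≫ r, hsr⟩⟩
    have hn : n ∈ t := by
      by_contra hn
      have := IsZero.of_mono s (hK n hn)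
      exact S.not_isZero_top_obj i ((S.top i).map_isZero this)
    let q (m : ℤ) : Retract (L.X m) (K.X m) := p.map (HomologicalComplex.eval C (.up ℤ) m)
    have hlt : ∑ m ∈ t, S.length (L.X m) < N := h ▸ Finset.sum_lt_sum
      (fun m _ => S.length_le_of_retract (q m)) ⟨n, hn, S.length_lt_of_retract (q n) s hsp⟩
    obtain ⟨M, hM, hmin, ⟨e'⟩⟩ := ih _ hlt L (fun m hm => (hK m hm).of_mono (q m).i) rfl
    exact ⟨M, hM, hmin, ⟨e.trans e'⟩⟩

end Minimal

section HomologyTop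

variable (S)

/-- The functor `K ↦ Hⁿ(top i K)`. On minimal complexes it is `K ↦ top i Kⁿ`. -/
abbrev homologyTop (i : ι) (n : ℤ) : HomotopyCategory C (.up ℤ) ⥤ ModuleCat.{v} k :=
  (S.top i).mapHomotopyCategory (.up ℤ) ⋙ HomotopyCategory.homologyFunctor _ _ n

lemma IsMinimal.nonempty_homologyTop_iso {S : TopSystem.{v} k C ι} {K : CochainComplex C ℤ}
    (hK : S.IsMinimal K) (i : ι) (n : ℤ) :
    Nonempty ((S.homologyTop i n).obj ((HomotopyCategory.quotient C _).obj K) ≅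
      (S.top i).obj (K.X n)) := by
  let L := ((S.top i).mapHomologicalComplex (.up ℤ)).obj K
  refine ⟨(HomotopyCategory.homologyFunctorFactors _ _ n).app L ≪≫
    (ShortComplex.HomologyData.ofZeros (L.sc n) (hK i _ _) (hK i _ _)).left.homologyIso⟩

end HomologyTop

end TopSystem

section Rigidity

open CochainComplex.HomComplex

variable {T : Type*} [Category* T] [Preadditive T] [HasShift T ℤ]

/-- There is no nonzero morphism `X ⟶ Y[1]`. -/
def HomShiftZero (X Y : T) : Prop := ∀ f : X ⟶ Y⟦(1 : ℤ)⟧, f = 0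

lemma HomShiftZero.of_retract {X Y X' Y' : T} (h : HomShiftZero X Y) (a : Retract X' X)
    (b : Retract Y' Y) : HomShiftZero X' Y' := by
  intro f
  have h₁ := h (a.r ≫ f ≫ b.i⟦(1 : ℤ)⟧')
  calc f = (a.i ≫ a.r) ≫ f ≫ (b.i ≫ b.r)⟦(1 : ℤ)⟧' := by simp
    _ = a.i ≫ (a.r ≫ f ≫ b.i⟦(1 : ℤ)⟧') ≫ b.r⟦(1 : ℤ)⟧' := by
      simp only [Functor.map_comp, Category.assoc]
    _ = 0 := by rw [h₁]; simp

lemma homShiftZero_iff_of_iso {X Y X' Y' : T} (a : X' ≅ X) (b : Y' ≅ Y) :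
    HomShiftZero X Y ↔ HomShiftZero X' Y' :=
  ⟨fun h => h.of_retract a.retract b.retract, fun h => h.of_retract a.symm.retract b.symm.retract⟩

lemma isRigid_biproduct_iff [∀ n : ℤ, (shiftFunctor T n).Additive] [HasFiniteBiproducts T]
    {ι : Type*} [Finite ι] (X : ι → T) :
    IsRigid (⨁ X) ↔ ∀ i j, HomShiftZero (X i) (X j) := by
  classical
  have := Fintype.ofFinite ι
  constructor
  · intro h i j
    exact HomShiftZero.of_retract (X := ⨁ X) (Y := ⨁ X) h
      ⟨biproduct.ι X i, biproduct.π X i, by simp⟩ ⟨biproduct.ι X j, biproduct.π X j, by simp⟩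
  · intro h f
    have h₁ : f = f ≫ (∑ j, biproduct.π X j ≫ biproduct.ι X j)⟦(1 : ℤ)⟧' := by
      rw [IsBilimit.total (biproduct.isBilimit X)]; simp
    rw [h₁]
    refine biproduct.hom_ext' _ _ fun i => ?_
    rw [Functor.map_sum, Preadditive.comp_sum, Preadditive.comp_sum, comp_zero]
    refine Finset.sum_eq_zero fun j _ => ?_
    have h₂ := h i j (biproduct.ι X i ≫ f ≫ (biproduct.π X j)⟦(1 : ℤ)⟧')
    simp only [Functor.map_comp]
    rw [← Category.assoc f, ← Category.assoc, h₂, zero_comp]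

end Rigidity

section TwoTerm

open CochainComplex.HomComplex

variable {C : Type*} [Category* C] [Preadditive C]

/-- A morphism `K⁻¹ ⟶ L⁰` is a cocycle of degree `1`, and hence a coboundary if there is no nonzero
morphism `K ⟶ L[1]` up to homotopy. -/
lemma HomShiftZero.exists_eq_d_comp_add_comp_d {K L : CochainComplex C ℤ}
    (h : HomShiftZero ((HomotopyCategory.quotient C (.up ℤ)).obj K)
      ((HomotopyCategory.quotient C (.up ℤ)).obj L))
    (hK : IsZero (K.X (-2))) (hL : IsZero (L.X 1)) (f : K.X (-1) ⟶ L.X 0) :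
    ∃ (a : K.X 0 ⟶ L.X 0) (b : K.X (-1) ⟶ L.X (-1)), f = K.d (-1) 0 ≫ a + b ≫ L.d (-1) 0 := by
  have hf : δ 1 2 (Cochain.single f 1) = 0 := by
    rw [Cochain.δ_single f 1 2 rfl (-2) 1 rfl rfl, hL.eq_of_tgt (f ≫ L.d 0 1) 0,
      hK.eq_of_src (K.d (-2) (-1) ≫ f) 0, Cochain.single_zero, Cochain.single_zero, smul_zero,
      add_zero]
  let α : Cocycle K L 1 := Cocycle.mk (Cochain.single f 1) 2 rfl hf
  have hα : CohomologyClass.toHom (.mk α) = 0 := by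
    rw [← cancel_mono (((HomotopyCategory.quotient C (.up ℤ)).commShiftIso (1 : ℤ)).hom.app L),
      zero_comp]
    exact h _
  obtain ⟨β, hβ⟩ := (mem_coboundaries_iff α 0 rfl).1
    ((CohomologyClass.toHom_mk_eq_zero_iff α).1 hα)
  refine ⟨-β.v 0 0 (add_zero 0), β.v (-1) (-1) (add_zero _), ?_⟩
  have hβ' := congrArg (fun γ : Cochain K L 1 => γ.v (-1) 0 (by omega)) hβ
  rw [δ_v 0 1 rfl β (-1) 0 _ (-1) 0 rfl rfl] at hβ'
  simpa [α, add_comm] using hβ'.symm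

end TwoTerm

/-! ### The Grothendieck group -/

section EulerCharacteristic

variable {k : Type*} [Field k]

lemma finrank_eq_finrank_range_add_finrank_range {S : ShortComplex (ModuleCat.{v} k)}
    (hS : S.Exact) [Module.Finite k S.X₂] :
    Module.finrank k S.X₂ =
      Module.finrank k (LinearMap.range S.f.hom) + Module.finrank k (LinearMap.range S.g.hom) := by
  rw [hS.moduleCat_range_eq_ker, add_comm, LinearMap.finrank_range_add_finrank_ker]

variable {T : Type*} [Category* T] [Preadditive T] [HasShift T ℤ] (H : T ⥤ ModuleCat.{v} k)
  [H.ShiftSequence ℤ]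

/-- The long exact sequence of `H` and `X` has only finitely many nonzero terms `Hⁿ X`, all of
finite dimension. -/
structure HasFiniteHomology (X : T) : Prop where
  finite (n : ℤ) : Module.Finite k ((H.shift n).obj X)
  finite_support :
    (GradedObject.finrankSupport fun n : ℤ => (H.shift n).obj X).Finite

/-- The Euler characteristic `∑ (-1)ⁿ dim Hⁿ X`. -/
def homologicalEulerChar (X : T) : ℤ :=
  GradedObject.eulerChar (.up ℤ) fun n : ℤ => (H.shift n).obj X

lemma finsum_negOnePow_sub_one {f : ℤ → ℤ} :
    ∑ᶠ n : ℤ, (n.negOnePow : ℤ) * f (n - 1) = -∑ᶠ n : ℤ, (n.negOnePow : ℤ) * f n := by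
  rw [← finsum_neg_distrib, ← finsum_comp_equiv (Equiv.addRight (1 : ℤ))]
  refine finsum_congr fun n => ?_
  simp [Int.negOnePow_succ]

variable [HasZeroObject T] [∀ n : ℤ, (shiftFunctor T n).Additive] [Pretriangulated T]
  [H.IsHomological]

theorem homologicalEulerChar_obj₂ (Δ : Triangle T) (hΔ : Δ ∈ distTriang T)
    (h₁ : HasFiniteHomology H Δ.obj₁) (h₂ : HasFiniteHomology H Δ.obj₂)
    (h₃ : HasFiniteHomology H Δ.obj₃) :
    homologicalEulerChar H Δ.obj₂ =
      homologicalEulerChar H Δ.obj₁ + homologicalEulerChar H Δ.obj₃ := by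
  have := h₁.finite
  have := h₂.finite
  have := h₃.finite
  let f (n : ℤ) : ℕ := Module.finrank k (LinearMap.range ((H.shift n).map Δ.mor₁).hom)
  let g (n : ℤ) : ℕ := Module.finrank k (LinearMap.range ((H.shift n).map Δ.mor₂).hom)
  let δ (n : ℤ) : ℕ :=
    Module.finrank k (LinearMap.range (H.homologySequenceδ Δ n (n + 1) rfl).hom)
  have e₁ (n : ℤ) : Module.finrank k ((H.shift n).obj Δ.obj₁) = δ (n - 1) + f n := by
    obtain ⟨m, rfl⟩ : ∃ m, n = m + 1 := ⟨n - 1, by omega⟩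
    rw [add_sub_cancel_right]
    exact finrank_eq_finrank_range_add_finrank_range (H.homologySequence_exact₁ Δ hΔ m _ rfl)
  have e₂ (n : ℤ) : Module.finrank k ((H.shift n).obj Δ.obj₂) = f n + g n :=
    finrank_eq_finrank_range_add_finrank_range (H.homologySequence_exact₂ Δ hΔ n)
  have e₃ (n : ℤ) : Module.finrank k ((H.shift n).obj Δ.obj₃) = g n + δ n :=
    finrank_eq_finrank_range_add_finrank_range (H.homologySequence_exact₃ Δ hΔ n _ rfl)
  have hsupp {u : ℤ → ℕ} {X : T} (hX : HasFiniteHomology H X)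
      (hu : ∀ n, u n ≤ Module.finrank k ((H.shift n).obj X)) :
      (Function.support fun n : ℤ => (n.negOnePow : ℤ) * u n).Finite :=
    hX.finite_support.subset fun n hn h => hn <| by
      simp [Nat.le_zero.1 ((hu n).trans_eq h)]
  have hf := hsupp h₂ fun n => le_self_add.trans_eq (e₂ n).symm
  have hg := hsupp h₂ fun n => le_add_self.trans_eq (e₂ n).symm
  have hδ := hsupp h₃ fun n => le_add_self.trans_eq (e₃ n).symm
  have hδ' := hsupp h₁ fun n => le_self_add.trans_eq (e₁ n).symm
  simp only [homologicalEulerChar, GradedObject.eulerChar, ComplexShape.eulerCharSignsUpInt_χ,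
    e₁, e₂, e₃, Nat.cast_add, mul_add]
  rw [finsum_add_distrib hδ' hf, finsum_add_distrib hf hg, finsum_add_distrib hg hδ,
    finsum_negOnePow_sub_one (f := fun n => δ n)]
  ring

end EulerCharacteristic

section Lift

variable {T : Type*} [Category* T] [Preadditive T] [HasZeroObject T] [HasShift T ℤ]
  [∀ n : ℤ, (shiftFunctor T n).Additive] [Pretriangulated T] {G : Type*} [AddCommGroup G]

/-- The homomorphism on the Grothendieck group induced by a function on objects which is additive
on distinguished triangles. -/
def K0.lift (χ : T → G) (hχ : ∀ Δ ∈ distTriang T, χ Δ.obj₂ = χ Δ.obj₁ + χ Δ.obj₃) : K0 T →+ G :=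
  QuotientAddGroup.lift _ (FreeAbelianGroup.lift χ) <| by
    rw [AddSubgroup.closure_le]
    rintro _ ⟨Δ, hΔ, rfl⟩
    simp [hχ Δ hΔ]

lemma K0.lift_of (χ : T → G) (hχ : ∀ Δ ∈ distTriang T, χ Δ.obj₂ = χ Δ.obj₁ + χ Δ.obj₃) (X : T) :
    K0.lift χ hχ (K0.of X) = χ X :=
  FreeAbelianGroup.lift_apply_of χ X

end Lift

section StupidFiltration

variable {C : Type*} [Category* C] [Preadditive C]

open HomologicalComplex

variable (K : CochainComplex C ℤ) (hK : ∀ n : ℤ, n ≠ -1 → n ≠ 0 → IsZero (K.X n))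

include hK in
lemma d_eq_zero_of_two_term {m n : ℤ} (h : m ≠ -1 ∨ n ≠ 0) : K.d m n = 0 := by
  by_cases hmn : m + 1 = n
  · subst hmn
    by_cases hm : m = 0
    · exact (hK _ (by omega) (by omega)).eq_of_tgt _ _
    · exact (hK _ (by omega) (by omega)).eq_of_src _ _
  · exact K.shape _ _ hmn

variable [HasZeroObject C]

/-- The sequence `K⁰ ⟶ K ⟶ K⁻¹[1]` for a complex `K` concentrated in degrees `-1` and `0`. -/
def stupidFiltration : ShortComplex (CochainComplex C ℤ) where
  X₁ := (single C (.up ℤ) 0).obj (K.X 0)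
  X₂ := K
  X₃ := (single C (.up ℤ) (-1)).obj (K.X (-1))
  f := mkHomFromSingle (𝟙 _) fun m _ => by
    rw [d_eq_zero_of_two_term K hK (.inl (by omega)), comp_zero]
  g := mkHomToSingle (𝟙 _) fun m _ => by
    rw [d_eq_zero_of_two_term K hK (.inr (by omega)), zero_comp]
  zero := by
    refine HomologicalComplex.hom_ext _ _ fun n => ?_
    by_cases h : n = 0
    · exact (isZero_single_obj_X (.up ℤ) (-1) _ n (by omega)).eq_of_tgt _ _
    · exact (isZero_single_obj_X (.up ℤ) 0 _ n h).eq_of_src _ _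

lemma nonempty_splitting_stupidFiltration (n : ℤ) :
    Nonempty ((stupidFiltration K hK).map (eval C _ n)).Splitting := by
  have isZero₁ (hn : n ≠ 0) := isZero_single_obj_X (.up ℤ) 0 (K.X 0) n hn
  have isZero₃ (hn : n ≠ -1) := isZero_single_obj_X (.up ℤ) (-1) (K.X (-1)) n hn
  rcases eq_or_ne n 0 with rfl | h₀
  · have : IsIso ((stupidFiltration K hK).f.f 0) := by
      simp only [stupidFiltration, mkHomFromSingle_f]
      infer_instance
    exact ⟨.ofIsIsoOfIsZero _ this (isZero₃ (by omega))⟩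
  have : IsIso ((stupidFiltration K hK).g.f n) := by
    rcases eq_or_ne n (-1) with rfl | h₁
    · simp only [stupidFiltration, mkHomToSingle_f]
      infer_instance
    · exact ⟨0, (hK n h₁ h₀).eq_of_src _ _, (isZero₃ h₁).eq_of_src _ _⟩
  exact ⟨.ofIsZeroOfIsIso _ (isZero₁ h₀) this⟩

end StupidFiltration

section Classes

variable {C : Type*} [Category* C] [Preadditive C] [HasZeroObject C] [HasBinaryBiproducts C]

open HomologicalComplex

lemma K0.of_distinguished {T : Triangle (HomotopyCategory C (.up ℤ))}
    (hT : T ∈ distTriang (HomotopyCategory C (.up ℤ))) (X₁ X₂ X₃ : BoundedHomotopyCategory C)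
    (e₁ : X₁.obj ≅ T.obj₁) (e₂ : X₂.obj ≅ T.obj₂) (e₃ : X₃.obj ≅ T.obj₃) :
    K0.of X₂ = K0.of X₁ + K0.of X₃ := by
  let f : X₁ ⟶ X₂ := ObjectProperty.homMk (e₁.hom ≫ T.mor₁ ≫ e₂.inv)
  obtain ⟨Z, g, h, hZ⟩ := distinguished_cocone_triangle f
  have hZ' : (bounded C).ι.mapTriangle.obj (Triangle.mk f g h) ∈
    distTriang (HomotopyCategory C (.up ℤ)) := hZ
  have e : Z.obj ≅ T.obj₃ := Triangle.π₃.mapIso (isoTriangleOfIso₁₂ _ _ hZ' hT e₁ e₂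
    (show (e₁.hom ≫ T.mor₁ ≫ e₂.inv) ≫ e₂.hom = e₁.hom ≫ T.mor₁ by simp))
  rw [K0.of_eq_of_iso ((bounded C).isoMk (e₃.trans e.symm) : X₃ ≅ Z)]
  exact K0.of_obj₂ _ hZ

lemma K0.of_degreewiseSplit (S : ShortComplex (CochainComplex C ℤ))
    (σ : ∀ n, (S.map (eval C _ n)).Splitting) (X₁ X₂ X₃ : BoundedHomotopyCategory C)
    (e₁ : X₁.obj ≅ (HomotopyCategory.quotient C (.up ℤ)).obj S.X₁)
    (e₂ : X₂.obj ≅ (HomotopyCategory.quotient C (.up ℤ)).obj S.X₂)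
    (e₃ : X₃.obj ≅ (HomotopyCategory.quotient C (.up ℤ)).obj S.X₃) :
    K0.of X₂ = K0.of X₁ + K0.of X₃ :=
  K0.of_distinguished (T := CochainComplex.trianglehOfDegreewiseSplit S σ)
    ((HomotopyCategory.distinguished_iff_iso_trianglehOfDegreewiseSplit _).2
      ⟨S, σ, ⟨Iso.refl _⟩⟩) X₁ X₂ X₃ e₁ e₂ e₃

lemma K0.of_inDegreeZero_of_iso_biprod {P Q Q' : C} (e : P ≅ Q ⊞ Q') :
    K0.of (inDegreeZero P) = K0.of (inDegreeZero Q) + K0.of (inDegreeZero Q') := by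
  let S : ShortComplex C := ShortComplex.mk (biprod.inl : Q ⟶ Q ⊞ Q') biprod.snd (by simp)
  let σ : S.Splitting := { r := biprod.fst, s := biprod.inr }
  exact K0.of_degreewiseSplit (S.map (single C (.up ℤ) 0))
    (fun n => (σ.map (single C (.up ℤ) 0)).map (eval C _ n)) _ _ _ (Iso.refl _)
    ((single C (.up ℤ) 0 ⋙ HomotopyCategory.quotient C (.up ℤ)).mapIso e) (Iso.refl _)

lemma K0.of_inDegreeZero_of_isZero {P : C} (h : IsZero P) : K0.of (inDegreeZero P) = 0 := by
  have e : P ≅ P ⊞ P :=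
    ⟨biprod.inl, biprod.fst, by simp, by ext <;> exact h.eq_of_src _ _⟩
  simpa using K0.of_inDegreeZero_of_iso_biprod e

lemma K0.of_shift {T : Type*} [Category* T] [Preadditive T] [HasZeroObject T] [HasShift T ℤ]
    [∀ n : ℤ, (shiftFunctor T n).Additive] [Pretriangulated T] (X : T) :
    K0.of (X⟦(1 : ℤ)⟧) = -K0.of X := by
  have h₀ : K0.of (0 : T) = 0 := by
    simpa using K0.of_obj₂ _ (contractible_distinguished (0 : T))
  have h : K0.of (0 : T) = K0.of X + K0.of (X⟦(1 : ℤ)⟧) :=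
    K0.of_obj₂ _ (rot_of_distTriang _ (contractible_distinguished X))
  rw [h₀] at h
  exact (neg_eq_of_add_eq_zero_right h.symm).symm

lemma K0.of_twoTerm (X : BoundedHomotopyCategory C) (hX : IsTwoTerm X) :
    K0.of X = K0.of (inDegreeZero (X.obj.as.X 0)) - K0.of (inDegreeZero (X.obj.as.X (-1))) := by
  have h := K0.of_degreewiseSplit (stupidFiltration X.obj.as hX)
    (fun n => (nonempty_splitting_stupidFiltration _ hX n).some) (inDegreeZero (X.obj.as.X 0)) X
    ((inDegreeZero (X.obj.as.X (-1)))⟦(1 : ℤ)⟧) (Iso.refl _) (Iso.refl _)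
    (((bounded C).ι.commShiftIso (1 : ℤ)).app (inDegreeZero (X.obj.as.X (-1))) ≪≫
      ((HomotopyCategory.singleFunctors C).shiftIso 1 (-1) 0 (by omega)).app (X.obj.as.X (-1)))
  rw [h, K0.of_shift, sub_eq_add_neg]

end Classes

lemma finite_homology {k : Type*} [Field k] (S : ShortComplex (ModuleCat.{v} k))
    [Module.Finite k S.X₂] : Module.Finite k S.homology := by
  have : Module.Finite k S.cycles :=
    Module.Finite.of_injective S.iCycles.hom ((ModuleCat.mono_iff_injective _).1 inferInstance)
  exact Module.Finite.of_surjective S.homologyπ.hom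
    ((ModuleCat.epi_iff_surjective _).1 inferInstance)

lemma bounded_iff_exists_finset {C : Type*} [Category* C] [Preadditive C]
    (K : HomotopyCategory C (.up ℤ)) :
    bounded C K ↔ ∃ t : Finset ℤ, ∀ n ∉ t, IsZero (K.as.X n) := by
  constructor
  · rintro ⟨a, b, h⟩
    refine ⟨Finset.Icc a b, fun n hn => h n ?_⟩
    rwa [Finset.mem_Icc, not_and_or, not_le, not_le] at hn
  · rintro ⟨t, h⟩
    obtain ⟨a, ha⟩ := t.bddBelow
    obtain ⟨b, hb⟩ := t.bddAbove
    refine ⟨a, b, fun n hn => h n fun hnt => ?_⟩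
    exact hn.elim (ha hnt).not_gt (hb hnt).not_gt

namespace TopSystem

variable {k : Type*} [Field k] {C : Type*} [Category* C] [Preadditive C] {ι : Type*}
  (S : TopSystem.{v} k C ι)

lemma finite_homologyTop (i : ι) (n : ℤ) (K : HomotopyCategory C (.up ℤ)) :
    Module.Finite k ((S.homologyTop i n).obj K) := by
  let L := ((S.top i).mapHomologicalComplex (.up ℤ)).obj K.as
  have : Module.Finite k (L.sc n).X₂ := S.finite i (K.as.X n)
  have : Module.Finite k ((HomologicalComplex.homologyFunctor (ModuleCat k) _ n).obj L) :=
    finite_homology (L.sc n)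
  exact Module.Finite.equiv
    ((HomotopyCategory.homologyFunctorFactors _ _ n).app L).toLinearEquiv.symm

lemma isZero_homologyTop (i : ι) {n : ℤ} {K : HomotopyCategory C (.up ℤ)}
    (h : IsZero ((S.top i).obj (K.as.X n))) : IsZero ((S.homologyTop i n).obj K) := by
  let L := ((S.top i).mapHomologicalComplex (.up ℤ)).obj K.as
  exact (((L.sc n).exact_iff_isZero_homology).1 ((L.sc n).exact_of_isZero_X₂ h)).of_iso
    ((HomotopyCategory.homologyFunctorFactors _ _ n).app L)

lemma finrankSupport_homologyTop_subset (i : ι) {K : HomotopyCategory C (.up ℤ)} {t : Finset ℤ}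
    (hK : ∀ n ∉ t, IsZero (K.as.X n)) :
    (GradedObject.finrankSupport fun n : ℤ => (S.homologyTop i n).obj K) ⊆ t := by
  refine fun n hn => by_contra fun hnt => hn ?_
  have := ModuleCat.subsingleton_of_isZero
    (S.isZero_homologyTop i ((S.top i).map_isZero (hK n hnt)))
  exact Module.finrank_zero_of_subsingleton

/-- The homological functor `K ↦ H⁰(top i K)`. -/
abbrev homologyTopFunctor (i : ι) : BoundedHomotopyCategory C ⥤ ModuleCat.{v} k :=
  (bounded C).ι ⋙ S.homologyTop i 0

lemma hasFiniteHomology (i : ι) (X : BoundedHomotopyCategory C) :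
    HasFiniteHomology (S.homologyTopFunctor i) X where
  finite n := S.finite_homologyTop i n X.obj
  finite_support := by
    obtain ⟨t, ht⟩ := (bounded_iff_exists_finset _).1 X.property
    exact t.finite_toSet.subset (S.finrankSupport_homologyTop_subset i ht)

variable [HasZeroObject C] [HasBinaryBiproducts C]

/-- The coordinate of the vertex `i` on the Grothendieck group: the Euler characteristic of the
homology of `top i`. -/
def coordinate (i : ι) : K0 (BoundedHomotopyCategory C) →+ ℤ :=
  K0.lift (homologicalEulerChar (S.homologyTopFunctor i)) fun Δ hΔ =>
    homologicalEulerChar_obj₂ _ Δ hΔ (S.hasFiniteHomology i _) (S.hasFiniteHomology i _)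
      (S.hasFiniteHomology i _)

lemma coordinate_of_isTwoTerm (i : ι) {X : BoundedHomotopyCategory C} (hX : IsTwoTerm X) :
    S.coordinate i (K0.of X) = Module.finrank k ((S.homologyTop i 0).obj X.obj) -
      Module.finrank k ((S.homologyTop i (-1)).obj X.obj) := by
  refine (K0.lift_of _ _ X).trans ((GradedObject.eulerChar_eq_sum_finSet_of_finrankSupport_subset
    _ _ {0, -1} (S.finrankSupport_homologyTop_subset i fun n hn => ?_)).trans ?_)
  · exact hX n (by grind) (by grind)
  · rw [Finset.sum_pair (by decide)]
    simp [sub_eq_add_neg]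

end TopSystem

/-! ### Fully faithful functors and silting complexes -/

section FullyFaithful

variable {C D : Type*} [Category* C] [Preadditive C] [Category* D] [Preadditive D] (F : C ⥤ D)
  [F.Full] [F.Faithful]

lemma homShiftZero_map_iff [HasShift C ℤ] [HasShift D ℤ] [F.PreservesZeroMorphisms] [F.CommShift ℤ]
    (X Y : C) : HomShiftZero (F.obj X) (F.obj Y) ↔ HomShiftZero X Y := by
  constructor
  · intro h f
    apply F.map_injective
    rw [F.map_zero, ← cancel_mono ((F.commShiftIso (1 : ℤ)).hom.app Y), zero_comp]
    exact h _
  · intro h f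
    obtain ⟨g, hg⟩ := F.map_surjective (f ≫ (F.commShiftIso (1 : ℤ)).inv.app Y)
    rw [h g, F.map_zero] at hg
    rw [← cancel_mono ((F.commShiftIso (1 : ℤ)).inv.app Y), ← hg, zero_comp]

variable [F.Additive]

lemma indecomposable_iff_of_essImage [HasBinaryBiproducts C] [HasBinaryBiproducts D]
    [F.essImage.IsStableUnderRetracts] (X : C) :
    Indecomposable (F.obj X) ↔ Indecomposable X := by
  have := preservesBinaryBiproducts_of_preservesBiproducts F
  have isZero_iff (Y : C) : IsZero (F.obj Y) ↔ IsZero Y :=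
    ⟨IsZero.of_full_of_faithful_of_isZero F Y, F.map_isZero⟩
  refine and_congr (isZero_iff X).not ⟨fun h Y Z e => ?_, fun h Y Z e => ?_⟩
  · simpa only [isZero_iff] using h _ _ (F.mapIso e ≪≫ F.mapBiprod Y Z)
  · have hY : F.essImage Y := F.essImage.prop_of_retract
      ⟨biprod.inl ≫ e.inv, e.hom ≫ biprod.fst, by simp⟩ (F.obj_mem_essImage X)
    have hZ : F.essImage Z := F.essImage.prop_of_retract
      ⟨biprod.inr ≫ e.inv, e.hom ≫ biprod.snd, by simp⟩ (F.obj_mem_essImage X)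
    obtain ⟨Y', ⟨eY⟩⟩ := hY
    obtain ⟨Z', ⟨eZ⟩⟩ := hZ
    have e' : X ≅ Y' ⊞ Z' := F.preimageIso
      (e ≪≫ biprod.mapIso eY.symm eZ.symm ≪≫ (F.mapBiprod Y' Z').symm)
    rw [← eY.isZero_iff, ← eZ.isZero_iff, isZero_iff, isZero_iff]
    exact h _ _ e'

lemma exists_mapHomologicalComplex_iso {ι : Type*} {c : ComplexShape ι}
    (K : HomologicalComplex D c) (h : ∀ n, F.essImage (K.X n)) :
    ∃ L : HomologicalComplex C c, Nonempty ((F.mapHomologicalComplex c).obj L ≅ K) := by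
  choose X e using h
  let e' n := (e n).some
  let L : HomologicalComplex C c :=
    { X := X
      d := fun i j => F.preimage ((e' i).hom ≫ K.d i j ≫ (e' j).inv)
      shape := fun i j hij => F.map_injective (by
        rw [F.map_preimage, K.shape i j hij, zero_comp, comp_zero, F.map_zero])
      d_comp_d' := fun i j l _ _ => F.map_injective (by simp) }
  have comm (i j) : (e' i).hom ≫ K.d i j = F.map (L.d i j) ≫ (e' j).hom := by simp [L]
  exact ⟨L, ⟨HomologicalComplex.Hom.isoOfComponents e' fun i j _ => comm i j⟩⟩

end FullyFaithful

section BoundedMap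

variable {C D : Type*} [Category* C] [Preadditive C] [Category* D] [Preadditive D]

/-- The functor between bounded homotopy categories induced by an additive functor. -/
def boundedMap (F : C ⥤ D) [F.Additive] : BoundedHomotopyCategory C ⥤ BoundedHomotopyCategory D :=
  (bounded D).lift ((bounded C).ι ⋙ F.mapHomotopyCategory (.up ℤ)) fun X => by
    obtain ⟨a, b, h⟩ := X.property
    exact ⟨a, b, fun n hn => F.map_isZero (h n hn)⟩

variable (F : C ⥤ D) [F.Additive]

instance : (boundedMap F).Additive where
  map_add := by
    intros
    ext : 1
    exact (F.mapHomotopyCategory (.up ℤ)).map_add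

lemma isTwoTerm_boundedMap {X : BoundedHomotopyCategory C} (hX : IsTwoTerm X) :
    IsTwoTerm ((boundedMap F).obj X) := fun n h₁ h₀ => F.map_isZero (hX n h₁ h₀)

variable [F.Full] [F.Faithful]

instance : (boundedMap F).Full := by unfold boundedMap; infer_instance

instance : (boundedMap F).Faithful := by unfold boundedMap; infer_instance

lemma homShiftZero_boundedMap_iff (X Y : BoundedHomotopyCategory C) :
    HomShiftZero ((boundedMap F).obj X) ((boundedMap F).obj Y) ↔ HomShiftZero X Y := by
  rw [← homShiftZero_map_iff (bounded D).ι, ← homShiftZero_map_iff (bounded C).ι]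
  exact homShiftZero_map_iff (F.mapHomotopyCategory (.up ℤ)) X.obj Y.obj

end BoundedMap

section SimplicialComplexes

lemma areIsomorphic_inducedSubcomplex_range {α β : Type*} {K : AbstractSimplicialComplex α}
    {L : AbstractSimplicialComplex β} (f : α ↪ β)
    (hf : ∀ s : Finset α, s ∈ K.faces ↔ s.map f ∈ L.faces) :
    AreIsomorphic K (inducedSubcomplex L (Set.range f)) := by
  refine ⟨Equiv.ofInjective f f.injective, fun s => (hf s).trans ?_⟩
  change _ ↔ (s.map _).map _ ∈ L.faces
  rw [Finset.map_map]
  rfl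

end SimplicialComplexes

section SiltingComplexes

variable {A B : Type u} [Ring A] [Ring B]

lemma mem_siltingComplex_faces_iff (s : Finset (SiltingVertex A)) :
    s ∈ (siltingComplex A).faces ↔
      s.Nonempty ∧ ∀ v ∈ s, ∀ w ∈ s, HomShiftZero v.rep w.rep := by
  refine and_congr_right fun _ => ?_
  rw [isRigid_biproduct_iff]
  simp

namespace SiltingVertex

lemma nonempty_rep_mk_iso (X : IndecomposableRigid A) :
    Nonempty (rep (Quotient.mk _ X) ≅ X.1) :=
  Quotient.exact (Quotient.out_eq (Quotient.mk (indecomposableRigidSetoid A) X))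

lemma gVector_eq_of_rep (v : SiltingVertex A) : v.gVector = K0.of v.rep := by
  conv_lhs => rw [← Quotient.out_eq v]
  rfl

variable (F : Proj B ⥤ Proj A) [F.Additive] [F.Full] [F.Faithful]
  [(boundedMap F).essImage.IsStableUnderRetracts]

/-- The map on vertices of silting complexes induced by a fully faithful functor between categories
of projective modules. -/
def map : SiltingVertex B → SiltingVertex A :=
  Quotient.map (sa := indecomposableRigidSetoid B) (sb := indecomposableRigidSetoid A)
    (fun X => ⟨(boundedMap F).obj X.1, isTwoTerm_boundedMap F X.2.1,
      (homShiftZero_boundedMap_iff F X.1 X.1).2 X.2.2.1,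
      (indecomposable_iff_of_essImage (boundedMap F) X.1).2 X.2.2.2⟩)
    fun _ _ ⟨e⟩ => ⟨(boundedMap F).mapIso e⟩

lemma nonempty_rep_map_iso (v : SiltingVertex B) :
    Nonempty ((map F v).rep ≅ (boundedMap F).obj v.rep) := by
  conv => enter [1, 1, 1]; rw [← Quotient.out_eq v]
  exact nonempty_rep_mk_iso _

lemma map_injective : Function.Injective (map F) := by
  intro v w h
  obtain ⟨e⟩ := nonempty_rep_map_iso F v
  obtain ⟨e'⟩ := nonempty_rep_map_iso F w
  rw [← Quotient.out_eq v, ← Quotient.out_eq w]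
  exact Quotient.sound ⟨(boundedMap F).preimageIso (e.symm ≪≫ eqToIso (by rw [h]) ≪≫ e')⟩

lemma mem_range_map_iff (v : SiltingVertex A) :
    v ∈ Set.range (map F) ↔
      ∃ Y : KbProj B, IsTwoTerm Y ∧ Nonempty ((boundedMap F).obj Y ≅ v.rep) := by
  constructor
  · rintro ⟨w, rfl⟩
    exact ⟨w.rep, (Quotient.out w).2.1, (nonempty_rep_map_iso F w).map Iso.symm⟩
  · rintro ⟨Y, hY, ⟨e⟩⟩
    have hrig : IsRigid Y := (homShiftZero_boundedMap_iff F Y Y).1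
      ((homShiftZero_iff_of_iso e e).1 v.isRigid_rep)
    have hind : Indecomposable Y := (indecomposable_iff_of_essImage (boundedMap F) Y).1
      ⟨fun h => (Quotient.out v).2.2.2.1 (h.of_iso e.symm),
        fun P Q i => (Quotient.out v).2.2.2.2 P Q (e.symm ≪≫ i)⟩
    refine ⟨Quotient.mk _ ⟨Y, hY, hrig, hind⟩, ?_⟩
    rw [← Quotient.out_eq v]
    exact Quotient.sound ⟨e⟩

end SiltingVertex

theorem areIsomorphic_siltingComplex_range (F : Proj B ⥤ Proj A) [F.Additive] [F.Full]
    [F.Faithful] [(boundedMap F).essImage.IsStableUnderRetracts] :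
    AreIsomorphic (siltingComplex B)
      (inducedSubcomplex (siltingComplex A) (Set.range (SiltingVertex.map F))) := by
  refine areIsomorphic_inducedSubcomplex_range ⟨_, SiltingVertex.map_injective F⟩ fun s => ?_
  rw [mem_siltingComplex_faces_iff, mem_siltingComplex_faces_iff]
  simp only [Finset.map_nonempty, Finset.mem_map, forall_exists_index, and_imp,
    forall_apply_eq_imp_iff₂]
  refine and_congr_right fun _ => forall₂_congr fun v _ => forall₂_congr fun w _ => ?_
  obtain ⟨e⟩ := SiltingVertex.nonempty_rep_map_iso F v
  obtain ⟨e'⟩ := SiltingVertex.nonempty_rep_map_iso F w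
  rw [← homShiftZero_boundedMap_iff F]
  exact homShiftZero_iff_of_iso e e'

end SiltingComplexes

namespace TopSystem

variable {k : Type*} [Field k] {C : Type*} [Category* C] [Preadditive C] {ι : Type*}
  (S : TopSystem.{v} k C ι) (J : Set ι)

/-- The bounded complexes `K` such that `top i K` is acyclic for all `i ∉ J`. Up to homotopy, these
are the complexes whose terms are supported on `J`. -/
def HomologySupportedOn : ObjectProperty (BoundedHomotopyCategory C) :=
  fun X => ∀ i ∉ J, ∀ n, IsZero ((S.homologyTop i n).obj X.obj)

instance : (S.HomologySupportedOn J).IsStableUnderRetracts where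
  of_retract p h i hi n :=
    (h i hi n).of_mono ((p.map (bounded C).ι).map (S.homologyTop i n)).i

variable {S J}

lemma homologySupportedOn_of_forall {X : BoundedHomotopyCategory C}
    (hX : ∀ n, S.SupportedOn J (X.obj.as.X n)) : S.HomologySupportedOn J X :=
  fun i hi n => S.isZero_homologyTop i (hX n i hi)

lemma IsMinimal.homologySupportedOn_iff {X : BoundedHomotopyCategory C}
    (hX : S.IsMinimal X.obj.as) :
    S.HomologySupportedOn J X ↔ ∀ n, S.SupportedOn J (X.obj.as.X n) := by
  refine ⟨fun h n i hi => ?_, homologySupportedOn_of_forall⟩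
  obtain ⟨e⟩ := hX.nonempty_homologyTop_iso i n
  exact (h i hi n).of_iso e.symm

lemma IsMinimal.isZero_or_isZero_top {K : CochainComplex C ℤ} (hmin : S.IsMinimal K)
    (h₂ : IsZero (K.X (-2))) (h₁ : IsZero (K.X 1))
    (hrig : HomShiftZero ((HomotopyCategory.quotient C (.up ℤ)).obj K)
      ((HomotopyCategory.quotient C (.up ℤ)).obj K)) (i : ι) :
    IsZero ((S.top i).obj (K.X (-1))) ∨ IsZero ((S.top i).obj (K.X 0)) := by
  by_contra! ⟨h, h'⟩
  obtain ⟨s, r, hsr⟩ := S.exists_retract (i := i) (𝟙 (K.X (-1))) (by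
    rwa [CategoryTheory.Functor.map_id, Ne, ← IsZero.iff_id_eq_zero])
  obtain ⟨s', r', hsr'⟩ := S.exists_retract (i := i) (𝟙 (K.X 0)) (by
    rwa [CategoryTheory.Functor.map_id, Ne, ← IsZero.iff_id_eq_zero])
  rw [Category.id_comp] at hsr hsr'
  obtain ⟨a, b, hab⟩ := hrig.exists_eq_d_comp_add_comp_d h₂ h₁ (r ≫ s')
  have hzero : (S.top i).map (r ≫ s') = 0 := by
    rw [hab, Functor.map_add, Functor.map_comp, Functor.map_comp, hmin, zero_comp, comp_zero,
      add_zero]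
  refine S.not_isZero_top_obj i ((IsZero.iff_id_eq_zero _).2 ?_)
  have hid : s ≫ (r ≫ s') ≫ r' = 𝟙 (S.obj i) := by
    simpa [hsr'] using hsr
  rw [← CategoryTheory.Functor.map_id, ← hid, Functor.map_comp, Functor.map_comp, hzero, zero_comp,
    comp_zero]

lemma exists_isMinimal_iso (S : TopSystem.{v} k C ι) [Finite ι] [IsIdempotentComplete C]
    (t : Finset ℤ) (X : BoundedHomotopyCategory C) (hX : ∀ n ∉ t, IsZero (X.obj.as.X n)) :
    ∃ Y : BoundedHomotopyCategory C, (∀ n ∉ t, IsZero (Y.obj.as.X n)) ∧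
      S.IsMinimal Y.obj.as ∧ Nonempty (X ≅ Y) := by
  obtain ⟨L, hL, hmin, ⟨e⟩⟩ := S.exists_isMinimal t X.obj.as hX
  exact ⟨⟨(HomotopyCategory.quotient C _).obj L, (bounded_iff_exists_finset _).2 ⟨t, hL⟩⟩, hL, hmin,
    ⟨(bounded C).isoMk (HomotopyCategory.isoOfHomotopyEquiv e)⟩⟩

section EssImage

variable [Finite ι] [IsIdempotentComplete C] {D : Type*} [Category* D] [Preadditive D] (F : D ⥤ C)
  [F.Additive] [F.Full] [F.Faithful]

lemma exists_boundedMap_iso (hF : F.essImage = S.SupportedOn J) {X : BoundedHomotopyCategory C}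
    (hX : S.HomologySupportedOn J X) (t : Finset ℤ) (ht : ∀ n ∉ t, IsZero (X.obj.as.X n)) :
    ∃ Y : BoundedHomotopyCategory D, (∀ n ∉ t, IsZero (Y.obj.as.X n)) ∧
      Nonempty ((boundedMap F).obj Y ≅ X) := by
  obtain ⟨X', ht', hmin, ⟨e⟩⟩ := S.exists_isMinimal_iso t X ht
  have hX' := hmin.homologySupportedOn_iff.1 ((S.HomologySupportedOn J).prop_of_iso e hX)
  obtain ⟨L, ⟨e'⟩⟩ := exists_mapHomologicalComplex_iso F X'.obj.as fun n => hF ▸ hX' n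
  have hL (n) (hn : n ∉ t) : IsZero (L.X n) := .of_full_of_faithful_of_isZero F _
    ((ht' n hn).of_iso ((HomologicalComplex.eval C (.up ℤ) n).mapIso e'))
  exact ⟨⟨(HomotopyCategory.quotient D _).obj L, (bounded_iff_exists_finset _).2 ⟨t, hL⟩⟩, hL,
    ⟨(bounded C).isoMk ((HomotopyCategory.quotient C (.up ℤ)).mapIso e') ≪≫ e.symm⟩⟩

lemma essImage_boundedMap (hF : F.essImage = S.SupportedOn J) :
    (boundedMap F).essImage = S.HomologySupportedOn J := by
  ext X
  constructor
  · rintro ⟨Y, ⟨e⟩⟩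
    refine (S.HomologySupportedOn J).prop_of_iso e (homologySupportedOn_of_forall fun n => ?_)
    exact hF ▸ F.obj_mem_essImage (Y.obj.as.X n)
  · intro hX
    obtain ⟨t, ht⟩ := (bounded_iff_exists_finset _).1 X.property
    obtain ⟨Y, -, hY⟩ := exists_boundedMap_iso F hF hX t ht
    exact ⟨Y, hY⟩

end EssImage

section Span

lemma finrank_homologyTop_eq_zero_iff (i : ι) (n : ℤ) (K : HomotopyCategory C (.up ℤ)) :
    Module.finrank k ((S.homologyTop i n).obj K) = 0 ↔ IsZero ((S.homologyTop i n).obj K) := by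
  have := S.finite_homologyTop i n K
  rw [Module.finrank_zero_iff, ModuleCat.isZero_iff_subsingleton]

variable [HasZeroObject C] [HasBinaryBiproducts C]

variable (S J) in
/-- The coordinate subspace of the Grothendieck group spanned by the classes of `obj j`, `j ∈ J`. -/
def coordinateSpan : AddSubgroup (K0 (BoundedHomotopyCategory C)) :=
  AddSubgroup.closure {x | ∃ j ∈ J, x = K0.of (inDegreeZero (S.obj j))}

lemma coordinate_inDegreeZero_obj {i j : ι} (hij : i ≠ j) :
    S.coordinate i (K0.of (inDegreeZero (S.obj j))) = 0 := by
  have hsupp : S.HomologySupportedOn {j} (inDegreeZero (S.obj j)) :=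
    homologySupportedOn_of_forall fun n => by
      rcases eq_or_ne n 0 with rfl | hn
      · exact (S.SupportedOn {j}).prop_of_iso
          (HomologicalComplex.singleObjXSelf (.up ℤ) 0 _).symm (S.supportedOn_obj rfl)
      · exact fun i _ => (S.top i).map_isZero
          (HomologicalComplex.isZero_single_obj_X (.up ℤ) 0 _ n hn)
  have h (n : ℤ) : Module.finrank k ((S.homologyTop i n).obj (inDegreeZero (S.obj j)).obj) = 0 :=
    (finrank_homologyTop_eq_zero_iff i n _).2 (hsupp i hij n)
  rw [S.coordinate_of_isTwoTerm i fun n _ h₀ =>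
    HomologicalComplex.isZero_single_obj_X (.up ℤ) 0 _ n h₀, h, h, sub_self]

lemma coordinate_eq_zero_of_mem {i : ι} (hi : i ∉ J) {x : K0 (BoundedHomotopyCategory C)}
    (hx : x ∈ S.coordinateSpan J) : S.coordinate i x = 0 := by
  have h : S.coordinateSpan J ≤ (S.coordinate i).ker := by
    refine (AddSubgroup.closure_le _).2 ?_
    rintro _ ⟨j, hj, rfl⟩
    exact coordinate_inDegreeZero_obj fun h => hi (h ▸ hj)
  exact h hx

variable [Finite ι] [IsIdempotentComplete C]

lemma SupportedOn.of_inDegreeZero_mem_coordinateSpan {X : C} (hX : S.SupportedOn J X) :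
    K0.of (inDegreeZero X) ∈ S.coordinateSpan J := by
  refine hX.induction (motive := fun X => K0.of (inDegreeZero X) ∈ S.coordinateSpan J)
    (fun X h => ?_) fun X Y j hj e hY => ?_
  · rw [K0.of_inDegreeZero_of_isZero h]
    exact zero_mem _
  · rw [K0.of_inDegreeZero_of_iso_biprod e]
    exact add_mem (AddSubgroup.subset_closure ⟨j, hj, rfl⟩) hY

theorem of_mem_coordinateSpan_iff {X : BoundedHomotopyCategory C} (hX : IsTwoTerm X)
    (hrig : IsRigid X) : K0.of X ∈ S.coordinateSpan J ↔ S.HomologySupportedOn J X := by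
  obtain ⟨Y, hY', hmin, ⟨e⟩⟩ := S.exists_isMinimal_iso {-1, 0} X (by simpa [IsTwoTerm] using hX)
  have hY : IsTwoTerm Y := by simpa [IsTwoTerm] using hY'
  rw [K0.of_eq_of_iso e, (S.HomologySupportedOn J).prop_iff_of_iso e]
  constructor
  · intro h i hi
    have hrigY : HomShiftZero Y.obj Y.obj := (homShiftZero_map_iff (bounded C).ι Y Y).2
      ((homShiftZero_iff_of_iso e.symm e.symm).1 hrig)
    have hor := (hmin.isZero_or_isZero_top (hY _ (by decide) (by decide))
      (hY _ (by decide) (by decide)) hrigY i).imp (S.isZero_homologyTop i) (S.isZero_homologyTop i)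
    have hcoord := coordinate_eq_zero_of_mem hi h
    rw [S.coordinate_of_isTwoTerm i hY] at hcoord
    have hiff : IsZero ((S.homologyTop i (-1)).obj Y.obj) ↔
        IsZero ((S.homologyTop i 0).obj Y.obj) := by
      rw [← finrank_homologyTop_eq_zero_iff, ← finrank_homologyTop_eq_zero_iff]
      lia
    intro n
    by_cases hn₁ : n = -1
    · exact hn₁ ▸ hor.elim id hiff.2
    by_cases hn₀ : n = 0
    · exact hn₀ ▸ hor.elim hiff.1 id
    · exact S.isZero_homologyTop i ((S.top i).map_isZero (hY n hn₁ hn₀))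
  · intro h
    rw [hmin.homologySupportedOn_iff] at h
    rw [K0.of_twoTerm Y hY]
    exact sub_mem (h 0).of_inDegreeZero_mem_coordinateSpan
      (h (-1)).of_inDegreeZero_mem_coordinateSpan

end Span

end TopSystem

/-! ### Projective modules over corner rings -/

section Proj

variable {A : Type u} [Ring A]

instance : HasFiniteProducts (Proj A) := hasFiniteProducts_of_has_binary_and_terminal

instance : HasFiniteBiproducts (Proj A) := HasFiniteBiproducts.of_hasFiniteProducts

instance : (finiteProjective A).IsStableUnderRetracts where
  of_retract {X Y} p hY := by
    have := hY.1
    have := hY.2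
    have hid : p.r.hom ∘ₗ p.i.hom = LinearMap.id := congrArg ModuleCat.Hom.hom p.retract
    exact ⟨Module.Finite.of_surjective p.r.hom fun x => ⟨p.i.hom x, LinearMap.congr_fun hid x⟩,
      Module.Projective.of_split p.i.hom p.r.hom hid⟩

instance : IsIdempotentComplete (Proj A) where
  idempotents_split X p hp := by
    obtain ⟨Y, i, r, hir, hri⟩ := IsIdempotentComplete.idempotents_split X.obj p.hom
      (congrArg InducedCategory.Hom.hom hp)
    exact ⟨⟨Y, (finiteProjective A).prop_of_retract ⟨i, r, hir⟩ X.property⟩,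
      ObjectProperty.homMk i, ObjectProperty.homMk r, by ext : 1; exact hir, by ext : 1; exact hri⟩

end Proj

namespace TopSystem

variable {A B : Type u} [Ring A] [Ring B] {k : Type*} [Field k] {ι : Type*} [Finite ι]
  {S : TopSystem.{v} k (Proj A) ι} {J : Set ι} (F : Proj B ⥤ Proj A) [F.Additive] [F.Full]
  [F.Faithful]

lemma mem_range_siltingVertexMap_iff (hF : F.essImage = S.SupportedOn J)
    [(boundedMap F).essImage.IsStableUnderRetracts] (v : SiltingVertex A) :
    v ∈ Set.range (SiltingVertex.map F) ↔ v.gVector ∈ S.coordinateSpan J := by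
  have hv : IsTwoTerm v.rep := (Quotient.out v).2.1
  rw [SiltingVertex.mem_range_map_iff, SiltingVertex.gVector_eq_of_rep,
    of_mem_coordinateSpan_iff hv v.isRigid_rep]
  constructor
  · rintro ⟨Y, -, hY⟩
    exact essImage_boundedMap F hF ▸ ⟨Y, hY⟩
  · intro h
    obtain ⟨Y, hY, e⟩ := exists_boundedMap_iso F hF h {-1, 0} (by simpa [IsTwoTerm] using hv)
    exact ⟨Y, by simpa [IsTwoTerm] using hY, e⟩

theorem areIsomorphic_siltingComplex (hF : F.essImage = S.SupportedOn J) :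
    AreIsomorphic (siltingComplex B)
      (inducedSubcomplex (siltingComplex A) {v | v.gVector ∈ S.coordinateSpan J}) := by
  have : (boundedMap F).essImage.IsStableUnderRetracts := by
    rw [essImage_boundedMap F hF]
    infer_instance
  have hrange : Set.range (SiltingVertex.map F) = {v | v.gVector ∈ S.coordinateSpan J} :=
    Set.ext (mem_range_siltingVertexMap_iff F hF)
  exact hrange ▸ areIsomorphic_siltingComplex_range F

end TopSystem

section AddClosure

variable {C : Type*} [Category.{u} C] [Preadditive C]

/-- The direct summands of finite direct sums of copies of `X`, encoded by a decomposition of the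
identity, which makes sense without assuming that these sums exist. -/
def addClosure (X : C) : ObjectProperty C :=
  fun Y => ∃ (n : ℕ) (i : Fin n → (Y ⟶ X)) (r : Fin n → (X ⟶ Y)), ∑ t, i t ≫ r t = 𝟙 Y

variable {X : C}

instance : (addClosure X).IsStableUnderRetracts where
  of_retract {Z Y} p hY := by
    obtain ⟨n, i, r, h⟩ := hY
    refine ⟨n, fun t => p.i ≫ i t, fun t => r t ≫ p.r, ?_⟩
    calc ∑ t, (p.i ≫ i t) ≫ r t ≫ p.r = p.i ≫ (∑ t, i t ≫ r t) ≫ p.r := by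
          simp only [Preadditive.comp_sum, Preadditive.sum_comp, Category.assoc]
      _ = 𝟙 Z := by rw [h, Category.id_comp, p.retract]

lemma addClosure_of_isZero {Y : C} (h : IsZero Y) : addClosure X Y :=
  ⟨0, fun _ => 0, fun _ => 0, h.eq_of_src _ _⟩

lemma addClosure_of_iso_biprod [HasBinaryBiproducts C] {Y Z W : C} (e : W ≅ Y ⊞ Z)
    (p : Retract Y X) (hZ : addClosure X Z) : addClosure X W := by
  refine (addClosure X).prop_of_iso e.symm ?_
  obtain ⟨n, i, r, h⟩ := hZ
  refine ⟨n + 1, Fin.cons (biprod.fst ≫ p.i) fun t => biprod.snd ≫ i t,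
    Fin.cons (p.r ≫ biprod.inl) fun t => r t ≫ biprod.inr, ?_⟩
  have hsnd : ∑ t, ((biprod.snd : Y ⊞ Z ⟶ Z) ≫ i t) ≫ r t ≫ biprod.inr =
      (biprod.snd ≫ biprod.inr : Y ⊞ Z ⟶ Y ⊞ Z) := by
    calc _ = biprod.snd ≫ (∑ t, i t ≫ r t) ≫ biprod.inr := by
          simp only [Preadditive.comp_sum, Preadditive.sum_comp, Category.assoc]
      _ = _ := by rw [h, Category.id_comp]
  rw [Fin.sum_univ_succ]
  simp only [Fin.cons_zero, Fin.cons_succ, hsnd]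
  rw [Category.assoc, p.retract_assoc, biprod.total]

lemma addClosure_biproduct [HasFiniteBiproducts C] (n : ℕ) :
    addClosure X (⨁ fun _ : Fin n => X) :=
  ⟨n, biproduct.π _, biproduct.ι _, biproduct.total⟩

end AddClosure

section HomFunctor

variable {C : Type*} [Category.{u} C] [Preadditive C]

/-- The functor `Hom(X, -)`, with values in the right modules over the endomorphism ring of `X`. -/
def homFunctor {B : Type u} [Ring B] (X : C) (σ : B ≃+* End X) : C ⥤ ModuleCat.{u} Bᵐᵒᵖ :=
  preadditiveCoyonedaObj X ⋙ ModuleCat.restrictScalars (RingHom.op (σ : B →+* End X))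

variable {B : Type u} [Ring B] (X : C) (σ : B ≃+* End X)

instance : (homFunctor X σ).Additive := by
  unfold homFunctor; infer_instance

variable {X}

/-- A linear map between two values of `homFunctor`, as a map between groups of morphisms. -/
def homFunctor.mapHom {Y Z : C} (g : (homFunctor X σ).obj Y ⟶ (homFunctor X σ).obj Z) :
    (X ⟶ Y) →+ (X ⟶ Z) :=
  g.hom.toAddMonoidHom

lemma homFunctor.mapHom_comp {Y Z : C} (g : (homFunctor X σ).obj Y ⟶ (homFunctor X σ).obj Z)
    (w : X ⟶ X) (u : X ⟶ Y) : mapHom σ g (w ≫ u) = w ≫ mapHom σ g u := by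
  have h : ∀ b : B, mapHom σ g (σ b ≫ u) = σ b ≫ mapHom σ g u := fun b =>
    g.hom.map_smul (MulOpposite.op b) u
  simpa using h (σ.symm w)

lemma homFunctor.map_eq_iff {Y Z : C} (g : (homFunctor X σ).obj Y ⟶ (homFunctor X σ).obj Z)
    (f : Y ⟶ Z) : (homFunctor X σ).map f = g ↔ ∀ u : X ⟶ Y, u ≫ f = mapHom σ g u :=
  ⟨fun h u => by rw [← h]; rfl, fun h => by ext u; exact h u⟩

lemma homFunctor.map_injective {Y Z : C} (hY : addClosure X Y) {f f' : Y ⟶ Z}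
    (h : (homFunctor X σ).map f = (homFunctor X σ).map f') : f = f' := by
  obtain ⟨n, i, r, hr⟩ := hY
  have h' := (homFunctor.map_eq_iff σ _ f).1 h
  calc f = (∑ t, i t ≫ r t) ≫ f := by rw [hr, Category.id_comp]
    _ = (∑ t, i t ≫ r t) ≫ f' := by
      simp only [Preadditive.sum_comp, Category.assoc]
      exact Finset.sum_congr rfl fun t _ => by rw [h']; rfl
    _ = f' := by rw [hr, Category.id_comp]

lemma homFunctor.exists_map_eq {Y Z : C} (hY : addClosure X Y)
    (g : (homFunctor X σ).obj Y ⟶ (homFunctor X σ).obj Z) :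
    ∃ f : Y ⟶ Z, (homFunctor X σ).map f = g := by
  obtain ⟨n, i, r, hr⟩ := hY
  refine ⟨∑ t, i t ≫ mapHom σ g (r t), (homFunctor.map_eq_iff σ _ _).2 fun u => ?_⟩
  calc u ≫ ∑ t, i t ≫ mapHom σ g (r t) = ∑ t, mapHom σ g ((u ≫ i t) ≫ r t) := by
        rw [Preadditive.comp_sum]
        exact Finset.sum_congr rfl fun t _ => by
          rw [homFunctor.mapHom_comp, Category.assoc]
    _ = mapHom σ g u := by
        rw [← map_sum]
        simp only [Category.assoc]
        rw [← Preadditive.comp_sum, hr, Category.comp_id]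

/-- Composition with morphisms to `X`, as a linear map. -/
def homFunctor.coords {Y : C} {n : ℕ} (i : Fin n → (Y ⟶ X)) :
    (homFunctor X σ).obj Y →ₗ[Bᵐᵒᵖ] (Fin n → Bᵐᵒᵖ) :=
  LinearMap.pi fun t =>
    { toFun := fun u : X ⟶ Y => MulOpposite.op (σ.symm (u ≫ i t))
      map_add' := fun (u v : X ⟶ Y) => by
        have h : (u + v) ≫ i t = u ≫ i t + v ≫ i t := Preadditive.add_comp ..
        exact congrArg (fun x => MulOpposite.op (σ.symm x)) h |>.trans
          (congrArg MulOpposite.op (map_add σ.symm (u ≫ i t) (v ≫ i t)))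
      map_smul' := fun b (u : X ⟶ Y) => by
        change MulOpposite.op (σ.symm ((σ b.unop ≫ u) ≫ i t)) =
          b * MulOpposite.op (σ.symm (u ≫ i t))
        have h : (σ b.unop ≫ u) ≫ i t = End.of (u ≫ i t) * σ b.unop := Category.assoc ..
        rw [h, map_mul, RingEquiv.symm_apply_apply]
        rfl }

/-- The linear combinations of morphisms from `X`. -/
def homFunctor.comb {Y : C} {n : ℕ} (r : Fin n → (X ⟶ Y)) :
    (Fin n → Bᵐᵒᵖ) →ₗ[Bᵐᵒᵖ] (homFunctor X σ).obj Y :=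
  Fintype.linearCombination Bᵐᵒᵖ (fun t => (r t : (homFunctor X σ).obj Y))

lemma homFunctor.comb_coords {Y : C} {n : ℕ} {i : Fin n → (Y ⟶ X)} {r : Fin n → (X ⟶ Y)}
    (hr : ∑ t, i t ≫ r t = 𝟙 Y) : comb σ r ∘ₗ coords σ i = LinearMap.id := by
  refine LinearMap.ext fun (u : X ⟶ Y) => ?_
  have h : ∑ t, σ (σ.symm (u ≫ i t)) ≫ r t = u := by
    calc _ = ∑ t, u ≫ i t ≫ r t := Finset.sum_congr rfl fun t _ => by
          rw [RingEquiv.apply_symm_apply, Category.assoc]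
      _ = u := by rw [← Preadditive.comp_sum, hr, Category.comp_id]
  exact h

lemma finiteProjective_homFunctor_obj {Y : C} (hY : addClosure X Y) :
    finiteProjective B ((homFunctor X σ).obj Y) := by
  obtain ⟨n, i, r, hr⟩ := hY
  have h := homFunctor.comb_coords σ hr
  exact ⟨Module.Finite.of_surjective (homFunctor.comb σ r)
    fun u => ⟨homFunctor.coords σ i u, LinearMap.congr_fun h u⟩,
    Module.Projective.of_split _ _ h⟩

variable (X) in
/-- The functor `Hom(X, -)` from the direct summands of the finite direct sums of copies of `X` to
the projective modules over the endomorphism ring of `X`. -/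
def addToProj : (addClosure X).FullSubcategory ⥤ Proj B :=
  (finiteProjective B).lift ((addClosure X).ι ⋙ homFunctor X σ)
    fun Y => finiteProjective_homFunctor_obj σ Y.property

instance : (addToProj X σ).Additive where
  map_add {Y Z f g} := by
    ext : 1
    exact (homFunctor X σ).map_add

instance : (addToProj X σ).Faithful where
  map_injective {Y Z f g} h := by
    ext : 1
    exact homFunctor.map_injective σ Y.property (congrArg (·.hom) h)

instance : (addToProj X σ).Full where
  map_surjective {Y Z} g := by
    obtain ⟨f, hf⟩ := homFunctor.exists_map_eq σ Y.property g.hom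
    exact ⟨ObjectProperty.homMk f, by ext : 1; exact hf⟩

lemma homFunctor.exists_iso_of_retract [IsIdempotentComplete C] {Y : C} (hY : addClosure X Y)
    {M : ModuleCat.{u} Bᵐᵒᵖ} (r : Retract M ((homFunctor X σ).obj Y)) :
    ∃ Z, addClosure X Z ∧ Nonempty ((homFunctor X σ).obj Z ≅ M) := by
  obtain ⟨p, hp⟩ := homFunctor.exists_map_eq σ hY (r.r ≫ r.i)
  have hpp : p ≫ p = p := homFunctor.map_injective σ hY (by
    rw [Functor.map_comp, hp, Category.assoc, r.retract_assoc])
  obtain ⟨Z, i, e, hie, hei⟩ := IsIdempotentComplete.idempotents_split Y p hpp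
  refine ⟨Z, (addClosure X).prop_of_retract ⟨i, e, hie⟩ hY, ⟨
    { hom := (homFunctor X σ).map i ≫ r.r
      inv := r.i ≫ (homFunctor X σ).map e
      hom_inv_id := ?_
      inv_hom_id := ?_ }⟩⟩
  · rw [Category.assoc, ← Category.assoc r.r, ← hp, ← Functor.map_comp, ← Functor.map_comp, ← hei,
      Category.assoc, hie, Category.comp_id, hie, CategoryTheory.Functor.map_id]
  · rw [Category.assoc, ← Category.assoc ((homFunctor X σ).map e), ← Functor.map_comp, hei, hp,
      Category.assoc, r.retract, Category.comp_id, r.retract]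

lemma homFunctor.coords_comb [HasFiniteBiproducts C] {n : ℕ} (c : Fin n → Bᵐᵒᵖ) :
    coords σ (biproduct.π fun _ : Fin n => X) (comb σ (biproduct.ι fun _ : Fin n => X) c) = c := by
  funext s
  have h : (∑ t, σ (c t).unop ≫ biproduct.ι (fun _ : Fin n => X) t) ≫
      biproduct.π (fun _ : Fin n => X) s = σ (c s).unop := by
    rw [Preadditive.sum_comp, Finset.sum_eq_single s]
    · rw [Category.assoc, biproduct.ι_π_self, Category.comp_id]
    · intro t _ hts
      rw [Category.assoc, biproduct.ι_π_ne _ hts, comp_zero]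
    · simp
  refine (congrArg (fun x => MulOpposite.op (σ.symm x)) h).trans ?_
  rw [RingEquiv.symm_apply_apply, MulOpposite.op_unop]

instance [HasFiniteBiproducts C] [IsIdempotentComplete C] : (addToProj X σ).EssSurj where
  mem_essImage P := by
    have := P.property.1
    have := P.property.2
    obtain ⟨n, f, hf⟩ := Module.Finite.exists_fin' Bᵐᵒᵖ P.obj
    obtain ⟨g, hg⟩ := Module.projective_lifting_property f LinearMap.id hf
    obtain ⟨Z, hZ, ⟨e⟩⟩ := homFunctor.exists_iso_of_retract σ (addClosure_biproduct n) (M := P.obj)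
      { i := ModuleCat.homEquiv.symm (homFunctor.comb σ _ ∘ₗ g)
        r := ModuleCat.homEquiv.symm (f ∘ₗ homFunctor.coords σ _)
        retract := by
          ext x
          exact (congrArg f (homFunctor.coords_comb σ (g x))).trans (LinearMap.congr_fun hg x) }
    exact ⟨⟨Z, hZ⟩, ⟨(finiteProjective B).isoMk e⟩⟩

theorem exists_fullyFaithful_of_end_equiv (σ : B ≃+* End X) [HasFiniteBiproducts C]
    [IsIdempotentComplete C] :
    ∃ F : Proj B ⥤ C, F.Full ∧ F.Faithful ∧ F.Additive ∧ F.essImage = addClosure X := by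
  have : (addToProj X σ).IsEquivalence := {}
  have : (addToProj X σ).asEquivalence.functor.Additive :=
    inferInstanceAs (addToProj X σ).Additive
  have : (addToProj X σ).inv.Additive := (addToProj X σ).asEquivalence.inverse_additive
  refine ⟨(addToProj X σ).inv ⋙ (addClosure X).ι, inferInstance, inferInstance, inferInstance,
    le_antisymm ?_ fun Y hY => ?_⟩
  · rintro Y ⟨P, ⟨e⟩⟩
    exact (addClosure X).prop_of_iso e ((addToProj X σ).inv.obj P).property
  · exact ⟨(addToProj X σ).obj ⟨Y, hY⟩, ⟨(addClosure X).ι.mapIso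
      ((addToProj X σ).asEquivalence.unitIso.symm.app ⟨Y, hY⟩)⟩⟩

end HomFunctor

namespace TopSystem

variable {k : Type*} [Field k] {C : Type*} [Category.{u} C] [Preadditive C] {ι : Type*} [Finite ι]
  [HasBinaryBiproducts C] [IsIdempotentComplete C] {S : TopSystem.{v} k C ι} {J : Set ι} {X : C}

lemma addClosure_eq_supportedOn (hX : S.SupportedOn J X) (p : ∀ j ∈ J, Retract (S.obj j) X) :
    addClosure X = S.SupportedOn J := by
  refine le_antisymm ?_ fun Y hY => ?_
  · rintro Y ⟨n, a, r, h⟩ i hi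
    have ha (t) : (S.top i).map (a t) = 0 := (hX i hi).eq_of_tgt _ _
    rw [IsZero.iff_id_eq_zero, ← CategoryTheory.Functor.map_id, ← h, Functor.map_sum]
    simp only [Functor.map_comp, ha, zero_comp, Finset.sum_const_zero]
  · exact hY.induction (motive := addClosure X) (fun _ h => addClosure_of_isZero h)
      fun _ _ j hj e h => addClosure_of_iso_biprod e (p j hj) h

end TopSystem

section Semilinear

variable {R S : Type*} [Ring R] [Ring S] {σ : R →+* S} {M N P : Type*} [AddCommGroup M] [Module R M]
  [AddCommGroup N] [Module S N] [AddCommGroup P] [Module R P]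

lemma exists_comp_eq_semilinear [Module.Projective R P] {f : M →ₛₗ[σ] N}
    (hf : Function.Surjective f) (g : P →ₛₗ[σ] N) : ∃ h : P →ₗ[R] M, f.comp h = g := by
  let := Module.compHom N σ
  let f' : M →ₗ[R] N := { f with map_smul' := f.map_smulₛₗ }
  let g' : P →ₗ[R] N := { g with map_smul' := g.map_smulₛₗ }
  obtain ⟨h, hh⟩ := Module.projective_lifting_property f' g' hf
  exact ⟨h, LinearMap.ext (LinearMap.congr_fun hh :)⟩

instance finite_semilinearMap {k : Type*} [Field k] {χ : R →+* k} [Module.Finite R M] :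
    Module.Finite k (M →ₛₗ[χ] k) := by
  obtain ⟨s, hs⟩ := Module.Finite.fg_top (R := R) (M := M)
  let ev : (M →ₛₗ[χ] k) →ₗ[k] (s → k) :=
    { toFun := fun l m => l m
      map_add' := fun _ _ => rfl
      map_smul' := fun _ _ => rfl }
  exact Module.Finite.of_injective ev fun l l' h =>
    LinearMap.ext_on hs fun m hm => congrFun h ⟨m, hm⟩

end Semilinear

section Characters

variable {R : Type*} [Ring R] {k ι : Type*} [Field k] {χ : ι → R →+* k} {M : Type*}
  [AddCommGroup M] [Module R M]

lemma mem_smul_top_of_forall_semilinear_eq_zero [Module.Projective R M] {m : M}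
    (hm : ∀ i (l : M →ₛₗ[χ i] k), l m = 0) :
    m ∈ (⨅ i, RingHom.ker (χ i)) • (⊤ : Submodule R M) := by
  obtain ⟨s, hs⟩ := Module.Projective.out (R := R) (P := M)
  have hcoeff (t : M) : s m t ∈ ⨅ i, RingHom.ker (χ i) := by
    refine (Submodule.mem_iInf _).2 fun i => ?_
    exact hm i ((χ i).toSemilinearMap.comp (Finsupp.lapply t ∘ₗ s))
  rw [← hs m, Finsupp.linearCombination_apply]
  exact Submodule.sum_mem _ fun t _ => Submodule.smul_mem_smul (hcoeff t) trivial

lemma range_pow_le_pow_smul_top {I : Ideal R} {f : Module.End R M}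
    (hf : LinearMap.range f ≤ I • ⊤) (n : ℕ) : LinearMap.range (f ^ n) ≤ I ^ n • ⊤ := by
  induction n with
  | zero => simp [Submodule.pow_zero]
  | succ n ih =>
    calc LinearMap.range (f ^ (n + 1)) = (LinearMap.range (f ^ n)).map f := by
          rw [pow_succ', Module.End.mul_eq_comp, LinearMap.range_comp]
      _ ≤ (I ^ n • ⊤ : Submodule R M).map f := Submodule.map_mono ih
      _ = I ^ n • LinearMap.range f := by rw [Submodule.map_smul'', Submodule.map_top]
      _ ≤ I ^ n • I • ⊤ := smul_mono_right _ hf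
      _ = I ^ (n + 1) • ⊤ := by rw [Submodule.pow_succ, Submodule.mul_smul]

lemma isNilpotent_of_forall_semilinear_comp_eq_zero [Module.Projective R M]
    (hχ : IsNilpotent (⨅ i, RingHom.ker (χ i))) {f : Module.End R M}
    (hf : ∀ i (l : M →ₛₗ[χ i] k), l.comp f = 0) : IsNilpotent f := by
  obtain ⟨n, hn⟩ := hχ
  have hrange : LinearMap.range f ≤ (⨅ i, RingHom.ker (χ i)) • ⊤ := by
    rintro _ ⟨m, rfl⟩
    exact mem_smul_top_of_forall_semilinear_eq_zero fun i l => LinearMap.congr_fun (hf i l) m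
  refine ⟨n, LinearMap.range_eq_bot.1 (le_bot_iff.1 ?_)⟩
  simpa [hn] using range_pow_le_pow_smul_top hrange n

end Characters

section SpanIdempotent

variable {A : Type*} [Ring A] {e : A}

lemma mem_span_idempotent_iff (he : IsIdempotentElem e) {x : A} :
    x ∈ Submodule.span Aᵐᵒᵖ {e} ↔ e * x = x := by
  rw [Submodule.mem_span_singleton]
  constructor
  · rintro ⟨a, rfl⟩
    rw [mul_smul_comm, he.eq]
  · intro h
    exact ⟨MulOpposite.op x, h⟩

variable (e) in
/-- The element `e`, as the generator of the right module `e A`. -/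
def spanGen : Submodule.span Aᵐᵒᵖ {e} := ⟨e, Submodule.mem_span_singleton_self e⟩

lemma op_smul_spanGen (he : IsIdempotentElem e) : MulOpposite.op e • spanGen e = spanGen e :=
  Subtype.ext he

variable {S : Type*} [Ring S] {σ : Aᵐᵒᵖ →+* S} {N : Type*} [AddCommGroup N] [Module S N]

lemma spanIdempotent_hom_ext {f g : Submodule.span Aᵐᵒᵖ {e} →ₛₗ[σ] N}
    (h : f (spanGen e) = g (spanGen e)) : f = g := by
  refine LinearMap.ext fun x => ?_
  obtain ⟨a, ha⟩ := Submodule.mem_span_singleton.1 x.2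
  obtain rfl : a • spanGen e = x := Subtype.ext ha
  rw [map_smulₛₗ, map_smulₛₗ, h]

lemma spanIdempotent_hom_eq_zero (he : IsIdempotentElem e) (hσ : σ (MulOpposite.op e) = 0)
    (f : Submodule.span Aᵐᵒᵖ {e} →ₛₗ[σ] N) : f = 0 :=
  spanIdempotent_hom_ext <| by
    rw [← op_smul_spanGen he, map_smulₛₗ, hσ, zero_smul, LinearMap.zero_apply]

variable (e σ) in
/-- The map `e A → N` that sends `e` to `n e`. -/
def spanLift (n : N) : Submodule.span Aᵐᵒᵖ {e} →ₛₗ[σ] N where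
  toFun x := σ (MulOpposite.op x.1) • n
  map_add' x y := by
    rw [Submodule.coe_add, MulOpposite.op_add, map_add, add_smul]
  map_smul' a x := by
    rw [smul_smul, ← map_mul]
    rfl

lemma spanLift_spanGen (n : N) : spanLift e σ n (spanGen e) = σ (MulOpposite.op e) • n := rfl

/-- The endomorphisms of the right module `e A` are the left multiplications by elements of
`e A e`. -/
def cornerEquivEnd (he : IsIdempotentElem e) :
    he.Corner ≃+* Module.End Aᵐᵒᵖ (Submodule.span Aᵐᵒᵖ {e}) where
  toFun a := spanLift e (RingHom.id _)
    ⟨a.1, (mem_span_idempotent_iff he).2 ((Subsemigroup.mem_corner_iff he).1 a.2).1⟩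
  invFun f := ⟨(f (spanGen e)).1, (Subsemigroup.mem_corner_iff he).2
    ⟨(mem_span_idempotent_iff he).1 (f (spanGen e)).2, by
      have h := f.map_smul (MulOpposite.op e) (spanGen e)
      rw [op_smul_spanGen he] at h
      exact (congrArg Subtype.val h).symm⟩⟩
  left_inv a := Subtype.ext ((Subsemigroup.mem_corner_iff he).1 a.2).2
  right_inv f := spanIdempotent_hom_ext <| by
    rw [spanLift_spanGen, RingHom.id_apply, Subtype.coe_eta, ← map_smul, op_smul_spanGen he]
  map_mul' a b := LinearMap.ext fun x => Subtype.ext (mul_assoc a.1 b.1 x.1)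
  map_add' a b := LinearMap.ext fun x => Subtype.ext (add_mul a.1 b.1 x.1)

end SpanIdempotent

section IdempotentProj

variable {A : Type u} [Ring A] {e e' : A}

/-- Endomorphisms in `Proj A` are endomorphisms of modules. -/
def endEquiv {P : Proj A} : End P ≃+* Module.End Aᵐᵒᵖ P.obj where
  toFun f := f.hom.hom
  invFun f := ObjectProperty.homMk (ModuleCat.ofHom f)
  map_mul' _ _ := rfl
  map_add' _ _ := rfl

/-- If `e' e = e` then `e A` is a direct summand of `e' A`. -/
def idempotentProjRetract (he : IsIdempotentElem e) (he' : IsIdempotentElem e') (h : e' * e = e) :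
    Retract (idempotentProj e he) (idempotentProj e' he') where
  i := ObjectProperty.homMk (ModuleCat.ofHom (spanLift e (RingHom.id _)
    ⟨e, (mem_span_idempotent_iff he').2 h⟩))
  r := ObjectProperty.homMk (ModuleCat.ofHom (spanLift e' (RingHom.id _) (spanGen e)))
  retract := by
    refine ObjectProperty.hom_ext _ (ModuleCat.hom_ext (spanIdempotent_hom_ext (Subtype.ext ?_)))
    change e * (e * e) = e
    rw [he.eq, he.eq]

end IdempotentProj

/-- Orthogonal idempotents `e i` of the ring `A` that represent its simple modules, which are the
one-dimensional modules given by the characters `aug i`. Modules are right modules, so the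
characters are defined on the opposite ring, and the nilpotent ideal is the radical of `A`. -/
structure VertexSystem (A k V : Type*) [Ring A] [Field k] where
  e : V → A
  orthogonalIdempotents : OrthogonalIdempotents e
  aug : V → Aᵐᵒᵖ →+* k
  aug_self (i : V) : aug i (MulOpposite.op (e i)) = 1
  aug_ne {i j : V} (h : i ≠ j) : aug i (MulOpposite.op (e j)) = 0
  aug_surjective (i : V) : Function.Surjective (aug i)
  isNilpotent_iInf_ker : IsNilpotent (⨅ i, RingHom.ker (aug i))

namespace VertexSystem

section Modules

variable {A k V : Type*} [Ring A] [Field k] (S : VertexSystem A k V)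

/-- The indecomposable projective module of the vertex `i`. -/
abbrev P (i : V) : Submodule Aᵐᵒᵖ A := Submodule.span Aᵐᵒᵖ {S.e i}

/-- The semilinear functionals on `M`, i.e. the homomorphisms from `M` to the simple module of the
vertex `i`. -/
abbrev Functional (i : V) (M : Type*) [AddCommGroup M] [Module Aᵐᵒᵖ M] : Type _ :=
  M →ₛₗ[S.aug i] k

/-- The functional on the projective module of the vertex `i` that sends the generator to `1`. -/
def canon (i : V) : S.Functional i (S.P i) := spanLift (S.e i) (S.aug i) 1

variable {S}

lemma canon_spanGen (i : V) : S.canon i (spanGen (S.e i)) = 1 := by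
  rw [canon, spanLift_spanGen, S.aug_self, one_smul]

lemma canon_surjective (i : V) : Function.Surjective (S.canon i) := fun c => by
  obtain ⟨a, rfl⟩ := S.aug_surjective i c
  exact ⟨a • spanGen (S.e i), by rw [map_smulₛₗ, canon_spanGen, smul_eq_mul, mul_one]⟩

lemma functional_eq_smul_canon {i : V} (l : S.Functional i (S.P i)) :
    l = l (spanGen (S.e i)) • S.canon i :=
  spanIdempotent_hom_ext <| by
    rw [LinearMap.smul_apply, canon_spanGen, smul_eq_mul, mul_one]

lemma functional_eq_zero {i j : V} (h : i ≠ j) (l : S.Functional i (S.P j)) : l = 0 :=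
  spanIdempotent_hom_eq_zero (S.orthogonalIdempotents.idem j) (S.aug_ne h) l

lemma isUnit_of_canon_comp_eq {i : V} [Module.Projective Aᵐᵒᵖ (S.P i)]
    (f : Module.End Aᵐᵒᵖ (S.P i)) (hf : (S.canon i).comp f = S.canon i) : IsUnit f := by
  have hcanon : (S.canon i).comp (1 - f) = 0 := by
    rw [LinearMap.comp_sub, hf]
    exact sub_self _
  have hnil : IsNilpotent (1 - f) := by
    refine isNilpotent_of_forall_semilinear_comp_eq_zero S.isNilpotent_iInf_ker fun j l => ?_
    obtain rfl | hij := eq_or_ne j i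
    · rw [functional_eq_smul_canon l, LinearMap.smul_comp, hcanon, smul_zero]
    · rw [functional_eq_zero hij l, LinearMap.zero_comp]
  have h : 1 - (1 - f) = f := sub_sub_cancel 1 f
  exact h ▸ IsNilpotent.isUnit_one_sub (R := Module.End Aᵐᵒᵖ (S.P i)) hnil

lemma exists_comp_eq_id {i : V} [Module.Projective Aᵐᵒᵖ (S.P i)] {M N : Type*} [AddCommGroup M]
    [Module Aᵐᵒᵖ M] [AddCommGroup N] [Module Aᵐᵒᵖ N] [Module.Projective Aᵐᵒᵖ N] (f : M →ₗ[Aᵐᵒᵖ] N)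
    (l : S.Functional i N) {x : M} (hx : l (f x) = 1) :
    ∃ (s : S.P i →ₗ[Aᵐᵒᵖ] M) (r : N →ₗ[Aᵐᵒᵖ] S.P i), r ∘ₗ f ∘ₗ s = LinearMap.id := by
  obtain ⟨r, hr⟩ := exists_comp_eq_semilinear (canon_surjective i) l
  let s : S.P i →ₗ[Aᵐᵒᵖ] M := spanLift (S.e i) (RingHom.id _) x
  have hcomp : (S.canon i).comp (r ∘ₗ f ∘ₗ s) = S.canon i := by
    refine spanIdempotent_hom_ext ?_
    calc (S.canon i).comp (r ∘ₗ f ∘ₗ s) (spanGen (S.e i)) = l (f (MulOpposite.op (S.e i) • x)) :=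
          LinearMap.congr_fun hr _
      _ = S.canon i (spanGen (S.e i)) := by
          rw [map_smul, map_smulₛₗ, S.aug_self, one_smul, hx, canon_spanGen]
  obtain ⟨w, hw⟩ := (isUnit_of_canon_comp_eq _ hcomp).exists_left_inv
  exact ⟨s, w ∘ₗ r, hw⟩

end Modules

section Category

variable {A k : Type u} {V : Type*} [Ring A] [Field k] (S : VertexSystem A k V)

/-- The module `S.P i` as an object of `Proj A`. -/
abbrev proj (i : V) : Proj A := idempotentProj (S.e i) (S.orthogonalIdempotents.idem i)

/-- The top of a projective module at the vertex `i`, as the space dual to the functionals. -/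
def topFunctor (i : V) : Proj A ⥤ ModuleCat.{u} k where
  obj Q := ModuleCat.of k (Module.Dual k (S.Functional i Q.obj))
  map f := ModuleCat.ofHom (LinearMap.lcompₛₗ k k (S.aug i) f.hom.hom).dualMap

variable {S}

lemma isZero_topFunctor_obj_iff {i : V} {Q : Proj A} :
    IsZero ((S.topFunctor i).obj Q) ↔ ∀ l : S.Functional i Q.obj, l = 0 :=
  ModuleCat.isZero_iff_subsingleton.trans <|
    (Module.subsingleton_dual_iff k).trans (subsingleton_iff_forall_eq 0)

lemma exists_apply_eq_one_of_topFunctor_map_ne_zero {i : V} {Q Q' : Proj A} {f : Q ⟶ Q'}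
    (hf : (S.topFunctor i).map f ≠ 0) :
    ∃ (l : S.Functional i Q'.obj) (x : Q.obj), l (f.hom.hom x) = 1 := by
  contrapose! hf
  have hzero : LinearMap.lcompₛₗ k k (S.aug i) f.hom.hom = 0 := by
    refine LinearMap.ext fun l => LinearMap.ext fun x => by_contra fun hx => ?_
    exact hf ((l (f.hom.hom x))⁻¹ • l) x (inv_mul_cancel₀ hx)
  refine ModuleCat.hom_ext ?_
  change (LinearMap.lcompₛₗ k k (S.aug i) f.hom.hom).dualMap = 0
  rw [hzero]
  exact LinearMap.ext fun φ => LinearMap.ext fun _ => map_zero φ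

lemma exists_retract {i : V} {Q Q' : Proj A} (f : Q ⟶ Q') (hf : (S.topFunctor i).map f ≠ 0) :
    ∃ (s : S.proj i ⟶ Q) (r : Q' ⟶ S.proj i), s ≫ f ≫ r = 𝟙 _ := by
  have := Q'.property.2
  have : Module.Projective Aᵐᵒᵖ (S.P i) := (S.proj i).property.2
  obtain ⟨l, x, hx⟩ := exists_apply_eq_one_of_topFunctor_map_ne_zero hf
  obtain ⟨s, r, hsr⟩ := exists_comp_eq_id f.hom.hom l hx
  exact ⟨ObjectProperty.homMk (ModuleCat.ofHom s), ObjectProperty.homMk (ModuleCat.ofHom r),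
    ObjectProperty.hom_ext _ (ModuleCat.hom_ext hsr)⟩

lemma isZero_of_isZero_topFunctor_obj {Q : Proj A} (h : ∀ i, IsZero ((S.topFunctor i).obj Q)) :
    IsZero Q := by
  have := Q.property.2
  obtain ⟨n, hn⟩ : IsNilpotent (1 : Module.End Aᵐᵒᵖ Q.obj) :=
    isNilpotent_of_forall_semilinear_comp_eq_zero S.isNilpotent_iInf_ker fun i l => by
      rw [isZero_topFunctor_obj_iff.1 (h i) l, LinearMap.zero_comp]
  rw [one_pow] at hn
  exact (IsZero.iff_id_eq_zero Q).2 (ObjectProperty.hom_ext _ (ModuleCat.hom_ext hn))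

lemma not_isZero_topFunctor_proj (i : V) : ¬ IsZero ((S.topFunctor i).obj (S.proj i)) := fun h => by
  have hcanon : S.canon i = 0 := isZero_topFunctor_obj_iff.1 h _
  simpa [hcanon] using canon_spanGen (S := S) i

variable (S) in
/-- The top system formed by the projective modules of the vertices. -/
def topSystem : TopSystem.{u} k (Proj A) V where
  obj := S.proj
  top := S.topFunctor
  additive i :=
    { map_add := ModuleCat.hom_ext (LinearMap.ext fun φ : Module.Dual k (S.Functional i _) =>
        LinearMap.ext fun l => (congrArg φ (LinearMap.comp_add _ _ _)).trans (map_add φ _ _)) }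
  finite i Q := by
    have := Q.property.1
    exact inferInstanceAs (Module.Finite k (Module.Dual k (S.Functional i Q.obj)))
  isZero_top_obj h := isZero_topFunctor_obj_iff.2 (functional_eq_zero h)
  not_isZero_top_obj := not_isZero_topFunctor_proj
  exists_retract := exists_retract
  isZero_of_isZero_top := isZero_of_isZero_topFunctor_obj

end Category

section SumIdempotent

variable {A k V : Type u} [Ring A] [Field k] (S : VertexSystem A k V) (J : Finset V)

lemma isIdempotentElem_sum : IsIdempotentElem (∑ j ∈ J, S.e j) :=
  S.orthogonalIdempotents.isIdempotentElem_sum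

lemma supportedOn_idempotentProj_sum :
    S.topSystem.SupportedOn J (idempotentProj _ (S.isIdempotentElem_sum J)) := fun i hi =>
  isZero_topFunctor_obj_iff.2 <| spanIdempotent_hom_eq_zero (S.isIdempotentElem_sum J) <| by
    rw [Finset.op_sum, map_sum]
    exact Finset.sum_eq_zero fun j hj => S.aug_ne (ne_of_mem_of_not_mem hj hi).symm

lemma sum_mul_e {j : V} (hj : j ∈ J) : (∑ i ∈ J, S.e i) * S.e j = S.e j := by
  classical
  rw [Finset.sum_mul, Finset.sum_eq_single_of_mem j hj fun i _ hij =>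
    S.orthogonalIdempotents.ortho hij, (S.orthogonalIdempotents.idem j).eq]

theorem exists_fullyFaithful_essImage_eq {B : Type u} [Ring B] [Finite V]
    (σ : B ≃+* (S.isIdempotentElem_sum J).Corner) :
    ∃ F : Proj B ⥤ Proj A,
      F.Full ∧ F.Faithful ∧ F.Additive ∧ F.essImage = S.topSystem.SupportedOn J := by
  obtain ⟨F, hFull, hFaithful, hAdditive, hF⟩ :=
    exists_fullyFaithful_of_end_equiv ((σ.trans (cornerEquivEnd _)).trans
      (endEquiv (P := idempotentProj _ (S.isIdempotentElem_sum J))).symm)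
  have hretract (j : V) (hj : j ∈ (J : Set V)) :
      Retract (S.topSystem.obj j) (idempotentProj _ (S.isIdempotentElem_sum J)) :=
    idempotentProjRetract (S.orthogonalIdempotents.idem j) _ (S.sum_mul_e J hj)
  exact ⟨F, hFull, hFaithful, hAdditive, hF.trans <|
    TopSystem.addClosure_eq_supportedOn (S.supportedOn_idempotentProj_sum J) hretract⟩

lemma coordinateSpan_topSystem : S.topSystem.coordinateSpan J =
    coordinateSubspace S.e S.orthogonalIdempotents.idem J := rfl

theorem areIsomorphic_siltingComplex {B : Type u} [Ring B] [Finite V]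
    (σ : B ≃+* (S.isIdempotentElem_sum J).Corner) :
    AreIsomorphic (siltingComplex B) (inducedSubcomplex (siltingComplex A)
      {v | v.gVector ∈ coordinateSubspace S.e S.orthogonalIdempotents.idem J}) := by
  obtain ⟨F, _, _, _, hF⟩ := S.exists_fullyFaithful_essImage_eq J σ
  rw [← S.coordinateSpan_topSystem]
  exact TopSystem.areIsomorphic_siltingComplex F hF

end SumIdempotent

end VertexSystem

/-! ### Shortcut quivers and their algebras -/

section Paths

variable {V : Type u} [Quiver.{u} V] {R : QuadraticRelations V} {J : Finset V}

open Quiver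

lemma AvoidsRelations.of_comp_left {i j l : V} {p : Path i j} {q : Path j l}
    (h : AvoidsRelations R (p.comp q)) : AvoidsRelations R p := by
  intro x y z p₁ a b p₂ hp
  exact h p₁ a b (p₂.comp q) (by rw [hp, Path.comp_assoc])

lemma AvoidsRelations.of_comp_right {i j l : V} {p : Path i j} {q : Path j l}
    (h : AvoidsRelations R (p.comp q)) : AvoidsRelations R q := by
  intro x y z p₁ a b p₂ hq
  refine h (p.comp p₁) a b p₂ ?_
  rw [hq, ← Path.comp_cons, ← Path.comp_cons, Path.comp_assoc]

lemma avoidsRelations_nil (i : V) : AvoidsRelations R (Path.nil : Path i i) := by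
  intro x y z p₁ a b p₂ hp
  have hlen := congrArg Path.length hp
  simp only [Path.length_comp, Path.length_cons, Path.length_nil] at hlen
  omega

lemma avoidsRelations_cons_iff {i j l : V} {p : Path i j} {c : j ⟶ l} :
    AvoidsRelations R (p.cons c) ↔
      AvoidsRelations R p ∧ ∀ ⦃x : V⦄ (p' : Path i x) (b : x ⟶ j), p = p'.cons b → ¬ R b c := by
  constructor
  · intro h
    refine ⟨AvoidsRelations.of_comp_left (q := c.toPath) h, fun x p' b hp => ?_⟩
    exact h p' b c Path.nil (by rw [hp, Path.comp_nil])
  · rintro ⟨h₁, h₂⟩ x y z p₁ a b p₂ hp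
    cases p₂ with
    | nil =>
      rw [Path.comp_nil] at hp
      cases hp
      exact h₂ p₁ a rfl
    | cons p₂ d =>
      rw [Path.comp_cons] at hp
      cases hp
      exact h₁ p₁ a b p₂ rfl

lemma AvoidsRelations.comp {i j l m : V} {p : Path i j} {q : Path j l} {r : Path l m}
    (hpq : AvoidsRelations R (p.comp q)) (hqr : AvoidsRelations R (q.comp r))
    (hq : 0 < q.length) : AvoidsRelations R ((p.comp q).comp r) := by
  induction r with
  | nil => exact hpq
  | cons r c ih =>
    rw [Path.comp_cons, avoidsRelations_cons_iff] at hqr ⊢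
    refine ⟨ih hqr.1, fun x p' b hp => ?_⟩
    obtain ⟨m, s, d, hs⟩ := (Path.length_ne_zero_iff_eq_cons (q.comp r)).1
      (by rw [Path.length_comp]; omega)
    rw [Path.comp_assoc, hs, Path.comp_cons] at hp
    cases hp
    exact hqr.2 _ _ hs

lemma length_eq_zero_of_comp_eq_nil {i j : V} {p : Path i j} {q : Path j i}
    (h : p.comp q = Path.nil) : p.length = 0 := by
  have hlen := congrArg Path.length h
  rw [Path.length_comp, Path.length_nil] at hlen
  omega

lemma exists_comp_eq_of_comp_eq_comp {i j j' l : V} {p : Path i j} {q : Path j l} {p' : Path i j'}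
    {q' : Path j' l} (h : p.comp q = p'.comp q') (hlen : q.length ≤ q'.length) :
    ∃ c : Path j' j, q' = c.comp q ∧ p = p'.comp c := by
  induction q with
  | nil => exact ⟨q', rfl, h⟩
  | @cons m l q b ih =>
    cases q' with
    | nil => simp at hlen
    | @cons m' _ q' b' =>
      rw [Path.comp_cons, Path.comp_cons] at h
      obtain rfl : m = m' := Path.obj_eq_of_cons_eq_cons h
      obtain ⟨c, hc, hc'⟩ := ih (eq_of_heq (Path.heq_of_cons_eq_cons h))
        (by simpa only [Path.length_cons, add_le_add_iff_right] using hlen)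
      refine ⟨c, ?_, hc'⟩
      rw [Path.comp_cons, hc, eq_of_heq (Path.hom_heq_of_cons_eq_cons h)]

/-- The path of the given quiver that corresponds to a path of the shortcut quiver. -/
def flatten {i : Shortcut R J} : ∀ {j : Shortcut R J}, Path i j → Path i.1 j.1
  | _, Path.nil => Path.nil
  | _, Path.cons p a => (flatten p).comp a.1

lemma flatten_nil (i : Shortcut R J) : flatten (Path.nil : Path i i) = Path.nil := rfl

lemma flatten_cons {i j l : Shortcut R J} (p : Path i j) (a : j ⟶ l) :
    flatten (p.cons a) = (flatten p).comp a.1 := rfl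

lemma flatten_comp {i j l : Shortcut R J} (p : Path i j) (q : Path j l) :
    flatten (p.comp q) = (flatten p).comp (flatten q) := by
  induction q with
  | nil => rfl
  | cons q a ih => rw [Path.comp_cons, flatten_cons, ih, flatten_cons, Path.comp_assoc]

lemma flatten_cons_ne_nil {i j : Shortcut R J} (p : Path i j) (a : j ⟶ i) :
    flatten (p.cons a) ≠ Path.nil := fun h => by
  have hlen := congrArg Path.length h
  rw [flatten_cons, Path.length_comp, Path.length_nil] at hlen
  exact a.2.1.ne' (Nat.add_eq_zero_iff.1 hlen).2

/-- If `b` were strictly longer than `a`, then the source of `a` would be an interior vertex of `b`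
that lies in `J`. -/
lemma eq_of_flatten_comp_eq_of_length_le {i j m m' : Shortcut R J} {p : Path i m} {q : Path i m'}
    {a : m ⟶ j} {b : m' ⟶ j} (h : (flatten p).comp a.1 = (flatten q).comp b.1)
    (hlen : a.1.length ≤ b.1.length) :
    ∃ e : m = m', a ≍ b ∧ flatten (e ▸ p) = flatten q := by
  obtain ⟨c, hb, hp⟩ := exists_comp_eq_of_comp_eq_comp h hlen
  have hc : c.length = 0 := by
    by_contra hc
    exact b.2.2.2 c a.1 hb (Nat.pos_of_ne_zero hc) a.2.1 m.2
  obtain rfl : m = m' := Subtype.ext (Path.eq_of_length_zero c hc).symm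
  obtain rfl := Path.eq_nil_of_length_zero c hc
  rw [Path.nil_comp] at hb
  exact ⟨rfl, heq_of_eq (Subtype.ext hb.symm), hp⟩

lemma flatten_injective {i j : Shortcut R J} :
    Function.Injective (flatten : Path i j → Path i.1 j.1) := by
  intro p
  induction p with
  | nil =>
    intro q h
    cases q with
    | nil => rfl
    | cons q a => exact absurd h.symm (flatten_cons_ne_nil q a)
  | cons p a ih =>
    intro q h
    cases q with
    | nil => exact absurd h (flatten_cons_ne_nil p a)
    | cons q b =>
      rcases le_total a.1.length b.1.length with hlen | hlen
      · obtain ⟨rfl, hab, hpq⟩ := eq_of_flatten_comp_eq_of_length_le h hlen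
        rw [eq_of_heq hab, ih hpq]
      · obtain ⟨rfl, hab, hpq⟩ := eq_of_flatten_comp_eq_of_length_le h.symm hlen
        rw [eq_of_heq hab, ih hpq.symm]

lemma exists_flatten_eq {i j : Shortcut R J} (p : Path i.1 j.1) (hp : AvoidsRelations R p) :
    ∃ q : Path i j, flatten q = p := by
  induction hn : p.length using Nat.strong_induction_on generalizing i j with
  | h n ih =>
    subst hn
    by_cases h₀ : p.length = 0
    · obtain rfl : i = j := Subtype.ext (Path.eq_of_length_zero p h₀)
      exact ⟨Path.nil, (Path.eq_nil_of_length_zero p h₀).symm⟩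
    by_cases h₁ : NoInteriorVertexIn J p
    · let a : i ⟶ j := ⟨p, Nat.pos_of_ne_zero h₀, hp, h₁⟩
      exact ⟨a.toPath, Path.nil_comp p⟩
    · unfold NoInteriorVertexIn at h₁
      push Not at h₁
      obtain ⟨x, p₁, p₂, rfl, hp₁, hp₂, hx⟩ := h₁
      rw [Path.length_comp] at ih
      let m : Shortcut R J := ⟨x, hx⟩
      obtain ⟨q₁, hq₁⟩ := ih p₁.length (by omega) (i := i) (j := m) p₁ hp.of_comp_left rfl
      obtain ⟨q₂, hq₂⟩ := ih p₂.length (by omega) (i := m) (j := j) p₂ hp.of_comp_right rfl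
      exact ⟨q₁.comp q₂, by rw [flatten_comp, hq₁, hq₂]⟩

lemma avoidsRelations_flatten_iff {i j : Shortcut R J} (p : Path i j) :
    AvoidsRelations R (flatten p) ↔ AvoidsRelations (shortcutRelations R J) p := by
  constructor
  · intro h x y z p₁ a b p₂ hp hab
    rw [hp, flatten_comp, flatten_cons, flatten_cons] at h
    have h := h.of_comp_left
    rw [Path.comp_assoc] at h
    exact hab h.of_comp_right
  · intro h
    induction p with
    | nil => exact avoidsRelations_nil _
    | cons p b ih =>
      rw [avoidsRelations_cons_iff] at h
      have ih := ih h.1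
      cases p with
      | nil =>
        rw [flatten_cons, flatten_nil, Path.nil_comp]
        exact b.2.2.1
      | cons p a =>
        rw [flatten_cons] at ih ⊢
        exact ih.comp (not_not.1 (h.2 p a rfl)) a.2.1

end Paths

section Concat

variable (k : Type u) [Field k] {V : Type u} [Quiver.{u} V]

open Quiver

lemma concat_apply_eq_zero {i l j : V} {f : Path i l →₀ k} {g : Path l j →₀ k} {p : Path i j}
    (h : ∀ q r, q.comp r = p → f q = 0 ∨ g r = 0) : concat k i l j f g p = 0 := by
  have hg : concat k i l j f g =
      f.sum fun q a => g.sum fun r b => Finsupp.single (q.comp r) (a * b) := by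
    rw [concat, Finsupp.linearCombination_apply, Finsupp.sum, LinearMap.sum_apply, Finsupp.sum]
    refine Finset.sum_congr rfl fun q _ => ?_
    rw [LinearMap.smul_apply, Finsupp.lmapDomain_apply, Finsupp.mapDomain, Finsupp.smul_sum]
    simp only [Finsupp.smul_single, smul_eq_mul]
  rw [hg, Finsupp.sum, Finsupp.finsetSum_apply]
  refine Finset.sum_eq_zero fun q _ => ?_
  rw [Finsupp.sum, Finsupp.finsetSum_apply]
  refine Finset.sum_eq_zero fun r _ => ?_
  by_cases hp : q.comp r = p
  · rcases h q r hp with h | h <;> simp [h]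
  · exact Finsupp.single_eq_of_ne (Ne.symm hp)

lemma concat_apply_nil {i : V} (f g : Path i i →₀ k) :
    concat k i i i f g Path.nil = f Path.nil * g Path.nil := by
  induction f using Finsupp.induction_linear with
  | zero => simp only [map_zero, LinearMap.zero_apply, Finsupp.zero_apply, zero_mul]
  | add f f' hf hf' => simp only [map_add, LinearMap.add_apply, Finsupp.add_apply, hf, hf', add_mul]
  | single q a =>
    induction g using Finsupp.induction_linear with
    | zero => simp only [map_zero, Finsupp.zero_apply, mul_zero]
    | add g g' hg hg' => simp only [map_add, Finsupp.add_apply, hg, hg', mul_add]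
    | single r b =>
      rw [concat_single]
      by_cases hq : q = Path.nil
      · subst hq
        by_cases hr : r = Path.nil
        · subst hr
          rw [Path.nil_comp, Finsupp.single_eq_same, Finsupp.single_eq_same,
            Finsupp.single_eq_same]
        · rw [Path.nil_comp, Finsupp.single_eq_of_ne (Ne.symm hr),
            Finsupp.single_eq_of_ne (Ne.symm hr), mul_zero]
      · have hqr : q.comp r ≠ Path.nil := fun h =>
          hq (Path.eq_nil_of_length_zero q (length_eq_zero_of_comp_eq_nil h))
        rw [Finsupp.single_eq_of_ne (Ne.symm hq), zero_mul, Finsupp.single_eq_of_ne hqr.symm]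

lemma concat_mapDomain_flatten {R : QuadraticRelations V} {J : Finset V} {i l j : Shortcut R J}
    (f : Path i l →₀ k) (g : Path l j →₀ k) :
    concat k i.1 l.1 j.1 (f.mapDomain flatten) (g.mapDomain flatten) =
      (concat k i l j f g).mapDomain flatten := by
  induction f using Finsupp.induction_linear with
  | zero => simp
  | add f f' hf hf' => simp only [map_add, LinearMap.add_apply, Finsupp.mapDomain_add, hf, hf']
  | single q a =>
    induction g using Finsupp.induction_linear with
    | zero => simp
    | add g g' hg hg' => simp only [map_add, Finsupp.mapDomain_add, hg, hg']
    | single r b => simp only [Finsupp.mapDomain_single, concat_single, flatten_comp]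

end Concat

section PathAlgebra

variable {k : Type u} [Field k] {V : Type u} [Quiver.{u} V]

open Quiver

namespace PathAlgebra

/-- The elements of the path algebra that are linear combinations of paths of length at
least `n`. -/
def IsDeep (n : ℕ) (f : PathAlgebra k V) : Prop :=
  ∀ ⦃i j : V⦄ (p : Path i j), p.length < n → f i j p = 0

lemma isDeep_zero (f : PathAlgebra k V) : IsDeep 0 f := fun _ _ _ h => absurd h (Nat.not_lt_zero _)

variable [DecidableEq V]

variable (k) in
/-- The inclusion of the linear combinations of paths from `i` to `j` into the path algebra. -/
def block (i j : V) : (Path i j →₀ k) →+ PathAlgebra k V where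
  toFun x := Pi.single (M := fun i => ∀ j : V, Path i j →₀ k) i
    (Pi.single (M := fun j => Path i j →₀ k) j x)
  map_zero' := by
    rw [Pi.single_zero, Pi.single_zero]
    rfl
  map_add' x y := by
    rw [Pi.single_add, Pi.single_add]
    rfl

lemma ofPath_eq_block {i j : V} (p : Path i j) :
    ofPath k p = block k i j (Finsupp.single p 1) := rfl

lemma block_apply (i j : V) (x : Path i j →₀ k) (i' j' : V) :
    block k i j x i' j' = Pi.single (M := fun i => ∀ j : V, Path i j →₀ k) i
      (Pi.single (M := fun j => Path i j →₀ k) j x) i' j' := rfl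

lemma block_same (i j : V) (x : Path i j →₀ k) : block k i j x i j = x := by
  rw [block_apply, Pi.single_eq_same, Pi.single_eq_same]

lemma block_of_ne_left {i j : V} (x : Path i j →₀ k) {i' : V} (j' : V) (h : i' ≠ i) :
    block k i j x i' j' = 0 := by
  rw [block_apply, Pi.single_eq_of_ne h, Pi.zero_apply]

lemma block_of_ne_right {i j : V} (x : Path i j →₀ k) (i' : V) {j' : V} (h : j' ≠ j) :
    block k i j x i' j' = 0 := by
  by_cases hi : i' = i
  · subst hi
    rw [block_apply, Pi.single_eq_same, Pi.single_eq_of_ne h]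
  · exact block_of_ne_left x j' hi

lemma ofPath_nil_apply_nil (i j : V) :
    ofPath k (Path.nil : Path i i) j j Path.nil = if j = i then 1 else 0 := by
  rw [ofPath_eq_block]
  split_ifs with h
  · subst h
    rw [block_same, Finsupp.single_eq_same]
  · rw [block_of_ne_left _ _ h, Finsupp.zero_apply]

variable [Fintype V]

protected lemma add_apply (f g : PathAlgebra k V) (i j : V) : (f + g) i j = f i j + g i j := rfl

protected lemma zero_apply (i j : V) : (0 : PathAlgebra k V) i j = 0 := rfl

protected lemma mul_apply (f g : PathAlgebra k V) (i j : V) :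
    (f * g) i j = ∑ l : V, concat k i l j (f i l) (g l j) := rfl

lemma one_apply_same (i : V) : (1 : PathAlgebra k V) i i = Finsupp.single Path.nil 1 :=
  Pi.single_eq_same (M := fun j => Path i j →₀ k) i _

protected lemma sum_apply {ι : Type*} (s : Finset ι) (f : ι → PathAlgebra k V) (i j : V) :
    (∑ x ∈ s, f x) i j = ∑ x ∈ s, f x i j :=
  map_sum (⟨⟨fun f : PathAlgebra k V => f i j, rfl⟩, fun _ _ => rfl⟩ :
    PathAlgebra k V →+ (Path i j →₀ k)) f s

lemma mul_apply_eq_zero {f g : PathAlgebra k V} {i j : V} {p : Path i j}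
    (h : ∀ ⦃l : V⦄ (q : Path i l) (r : Path l j), q.comp r = p → f i l q = 0 ∨ g l j r = 0) :
    (f * g) i j p = 0 := by
  rw [PathAlgebra.mul_apply, Finsupp.finsetSum_apply]
  exact Finset.sum_eq_zero fun l _ => concat_apply_eq_zero k (h (l := l))

lemma sum_block (f : PathAlgebra k V) : ∑ i, ∑ j, block k i j (f i j) = f := by
  funext x y
  rw [PathAlgebra.sum_apply, Fintype.sum_eq_single x fun i hi => ?_, PathAlgebra.sum_apply,
    Fintype.sum_eq_single y fun j hj => block_of_ne_right _ _ hj.symm, block_same]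
  rw [PathAlgebra.sum_apply]
  exact Finset.sum_eq_zero fun j _ => block_of_ne_left _ _ hi.symm

lemma block_mul_apply {i l : V} (x : Path i l →₀ k) (f : PathAlgebra k V) (j : V) :
    (block k i l x * f) i j = concat k i l j x (f l j) := by
  rw [PathAlgebra.mul_apply, Fintype.sum_eq_single l fun m hm => ?_, block_same]
  rw [block_of_ne_right x _ hm, map_zero, LinearMap.zero_apply]

lemma block_mul_apply_of_ne {i l : V} (x : Path i l →₀ k) (f : PathAlgebra k V) {i' : V} (j : V)
    (h : i' ≠ i) : (block k i l x * f) i' j = 0 := by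
  rw [PathAlgebra.mul_apply]
  refine Finset.sum_eq_zero fun m _ => ?_
  rw [block_of_ne_left x _ h, map_zero, LinearMap.zero_apply]

lemma mul_block_apply {l j : V} (f : PathAlgebra k V) (y : Path l j →₀ k) (i : V) :
    (f * block k l j y) i j = concat k i l j (f i l) y := by
  rw [PathAlgebra.mul_apply, Fintype.sum_eq_single l fun m hm => ?_, block_same]
  rw [block_of_ne_left y _ hm, map_zero]

lemma mul_block_apply_of_ne {l j : V} (f : PathAlgebra k V) (y : Path l j →₀ k) (i : V) {j' : V}
    (h : j' ≠ j) : (f * block k l j y) i j' = 0 := by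
  rw [PathAlgebra.mul_apply]
  exact Finset.sum_eq_zero fun m _ => by rw [block_of_ne_right y _ h, map_zero]

lemma block_mul_block {i l j : V} (x : Path i l →₀ k) (y : Path l j →₀ k) :
    block k i l x * block k l j y = block k i j (concat k i l j x y) := by
  funext i' j'
  by_cases hi : i' = i
  · subst hi
    by_cases hj : j' = j
    · subst hj
      rw [block_mul_apply, block_same, block_same]
    · rw [mul_block_apply_of_ne _ _ _ hj, block_of_ne_right _ _ hj]
  · rw [block_mul_apply_of_ne _ _ _ hi, block_of_ne_left _ _ hi]

lemma ofPath_nil_mul_apply (i : V) (f : PathAlgebra k V) (x y : V) :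
    (ofPath k (Path.nil : Path i i) * f) x y = if x = i then f x y else 0 := by
  rw [ofPath_eq_block]
  split_ifs with h
  · subst h
    rw [block_mul_apply, concat_nil_left]
  · exact block_mul_apply_of_ne _ _ _ h

lemma mul_ofPath_nil_apply (i : V) (f : PathAlgebra k V) (x y : V) :
    (f * ofPath k (Path.nil : Path i i)) x y = if y = i then f x y else 0 := by
  rw [ofPath_eq_block]
  split_ifs with h
  · subst h
    rw [mul_block_apply, concat_nil_right]
  · exact mul_block_apply_of_ne _ _ _ h

/-- The coefficient of the path of length zero at the vertex `i`, as a character of the path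
algebra. -/
def nilCoeff (i : V) : PathAlgebra k V →+* k where
  toFun f := f i i Path.nil
  map_zero' := rfl
  map_one' := by rw [one_apply_same, Finsupp.single_eq_same]
  map_add' _ _ := rfl
  map_mul' f g := by
    rw [PathAlgebra.mul_apply, Finsupp.finsetSum_apply, Fintype.sum_eq_single i fun l hl => ?_,
      concat_apply_nil]
    refine concat_apply_eq_zero k fun q r h => (hl ?_).elim
    exact (Path.eq_of_length_zero q (length_eq_zero_of_comp_eq_nil h)).symm

lemma isDeep_one {f : PathAlgebra k V} (hf : ∀ i, nilCoeff i f = 0) : IsDeep 1 f := by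
  intro i j p hp
  rw [Nat.lt_one_iff] at hp
  obtain rfl := Path.eq_of_length_zero p hp
  obtain rfl := Path.eq_nil_of_length_zero p hp
  exact hf i

lemma IsDeep.add {n : ℕ} {f g : PathAlgebra k V} (hf : IsDeep n f) (hg : IsDeep n g) :
    IsDeep n (f + g) := fun i j p hp => by
  rw [PathAlgebra.add_apply, Finsupp.add_apply, hf p hp, hg p hp, add_zero]

lemma IsDeep.mul {n m : ℕ} {f g : PathAlgebra k V} (hf : IsDeep n f) (hg : IsDeep m g) :
    IsDeep (n + m) (f * g) := by
  intro i j p hp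
  refine mul_apply_eq_zero fun l q r h => ?_
  rw [← h, Path.length_comp] at hp
  rcases lt_or_ge q.length n with hq | hq
  · exact Or.inl (hf q hq)
  · exact Or.inr (hg r (by omega))

end PathAlgebra

open PathAlgebra

variable [DecidableEq V] [Fintype V]

variable (k) in
/-- The elements of the path algebra all of whose paths contain a relation. -/
def spanOfRelations (R : QuadraticRelations V) : TwoSidedIdeal (PathAlgebra k V) :=
  TwoSidedIdeal.mk' {f | ∀ ⦃i j : V⦄ (p : Path i j), AvoidsRelations R p → f i j p = 0}
    (fun _ _ _ _ => rfl)
    (fun {f g} hf hg i j p hp => by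
      rw [PathAlgebra.add_apply, Finsupp.add_apply, hf p hp, hg p hp, add_zero])
    (fun {f} hf i j p hp => (congrArg Neg.neg (hf p hp)).trans neg_zero)
    (fun {_ _} hg _ _ _ hp => mul_apply_eq_zero fun _ _ r h =>
      Or.inr (hg r (AvoidsRelations.of_comp_right (h ▸ hp))))
    (fun {_ _} hf _ _ _ hp => mul_apply_eq_zero fun _ q _ h =>
      Or.inl (hf q (AvoidsRelations.of_comp_left (h ▸ hp))))

lemma mem_spanOfRelations {R : QuadraticRelations V} {f : PathAlgebra k V} :
    f ∈ spanOfRelations k R ↔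
      ∀ ⦃i j : V⦄ (p : Path i j), AvoidsRelations R p → f i j p = 0 :=
  TwoSidedIdeal.mem_mk' _ _ _ _ _ _ _

lemma block_single_mem_relationIdeal {R : QuadraticRelations V} {i j : V} {p : Path i j}
    (hp : ¬ AvoidsRelations R p) (c : k) :
    block k i j (Finsupp.single p c) ∈ relationIdeal k R := by
  unfold AvoidsRelations at hp
  push Not at hp
  obtain ⟨x, y, z, p₁, a, b, p₂, rfl, hab⟩ := hp
  have h : block k i j (Finsupp.single (((p₁.cons a).cons b).comp p₂) c) =
      block k i x (Finsupp.single p₁ c) * ofPath k (a.toPath.comp b.toPath) *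
        block k z j (Finsupp.single p₂ 1) := by
    rw [ofPath_eq_block, block_mul_block, block_mul_block, concat_single, concat_single, mul_one,
      mul_one]
    rfl
  rw [h]
  refine TwoSidedIdeal.mul_mem_right _ _ _ (TwoSidedIdeal.mul_mem_left _ _ _ ?_)
  exact TwoSidedIdeal.subset_span ⟨x, y, z, a, b, hab, rfl⟩

lemma ofPath_mem_spanOfRelations {R : QuadraticRelations V} {x y z : V} {a : x ⟶ y} {b : y ⟶ z}
    (hab : R a b) : ofPath k (a.toPath.comp b.toPath) ∈ spanOfRelations k R := by
  refine mem_spanOfRelations.2 fun i j p hp => ?_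
  rw [ofPath_eq_block]
  by_cases hi : i = x
  · subst hi
    by_cases hj : j = z
    · subst hj
      rw [block_same, Finsupp.single_eq_of_ne]
      rintro rfl
      exact hp Path.nil a b Path.nil rfl hab
    · rw [block_of_ne_right _ _ hj, Finsupp.zero_apply]
  · rw [block_of_ne_left _ _ hi, Finsupp.zero_apply]

lemma relationIdeal_eq (R : QuadraticRelations V) : relationIdeal k R = spanOfRelations k R := by
  refine le_antisymm (TwoSidedIdeal.span_le.2 ?_) fun f hf => ?_
  · rintro _ ⟨x, y, z, a, b, hab, rfl⟩
    exact ofPath_mem_spanOfRelations hab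
  · rw [mem_spanOfRelations] at hf
    rw [← sum_block f]
    refine sum_mem fun i _ => sum_mem fun j _ => ?_
    rw [← Finsupp.sum_single (f i j), Finsupp.sum, map_sum]
    exact sum_mem fun p hp => block_single_mem_relationIdeal
      (fun hp' => Finsupp.mem_support_iff.1 hp (hf p hp')) _

namespace BoundAlgebra

variable {R : QuadraticRelations V}

variable (k R) in
/-- The projection from the path algebra. -/
abbrev proj : PathAlgebra k V →+* BoundAlgebra k R := (relationIdeal k R).ringCon.mk'

lemma proj_surjective : Function.Surjective (proj k R) := RingCon.mk'_surjective _

lemma proj_eq_proj_iff {f g : PathAlgebra k V} :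
    proj k R f = proj k R g ↔
      ∀ ⦃i j : V⦄ (p : Path i j), AvoidsRelations R p → f i j p = g i j p := by
  have h : proj k R f = proj k R g ↔ f - g ∈ relationIdeal k R := by
    rw [← TwoSidedIdeal.rel_iff]
    exact RingCon.eq _
  rw [h, relationIdeal_eq, mem_spanOfRelations]
  exact forall_congr' fun i => forall_congr' fun j => forall₂_congr fun p _ => sub_eq_zero

variable (k R) in
/-- The coefficient of the idempotent of the vertex `i`, as a character of the bound algebra. -/
def aug (i : V) : BoundAlgebra k R →+* k :=
  RingCon.lift _ (nilCoeff i) fun _ _ h =>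
    proj_eq_proj_iff.1 ((RingCon.eq _).2 h) Path.nil (avoidsRelations_nil i)

lemma aug_proj (i : V) (f : PathAlgebra k V) : aug k R i (proj k R f) = nilCoeff i f := rfl

lemma aug_vertexIdempotent (i j : V) :
    aug k R i (vertexIdempotent k R j) = if i = j then 1 else 0 :=
  (aug_proj i _).trans (ofPath_nil_apply_nil j i)

lemma vertexIdempotent_mul_of_ne {i j : V} (h : i ≠ j) :
    vertexIdempotent k R i * vertexIdempotent k R j = 0 := by
  rw [vertexIdempotent, vertexIdempotent, ← map_mul, ← map_zero (proj k R)]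
  congr 1
  funext x y
  rw [ofPath_nil_mul_apply, PathAlgebra.zero_apply]
  split_ifs with hx
  · exact block_of_ne_left _ _ (hx ▸ h)
  · rfl

variable (k R) in
lemma orthogonalIdempotents_vertexIdempotent : OrthogonalIdempotents (vertexIdempotent k R) where
  idem := isIdempotentElem_vertexIdempotent k R
  ortho _ _ := vertexIdempotent_mul_of_ne

lemma exists_isDeep_of_mem_pow {I : Ideal (BoundAlgebra k R)ᵐᵒᵖ}
    (hI : ∀ x ∈ I, ∀ i, aug k R i x.unop = 0) {n : ℕ} {x : (BoundAlgebra k R)ᵐᵒᵖ}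
    (hx : x ∈ I ^ n) : ∃ f : PathAlgebra k V, proj k R f = x.unop ∧ IsDeep n f := by
  induction n generalizing x with
  | zero =>
    obtain ⟨f, hf⟩ := proj_surjective x.unop
    exact ⟨f, hf, isDeep_zero f⟩
  | succ n ih =>
    rw [Submodule.pow_succ, ← smul_eq_mul] at hx
    refine Submodule.smul_induction_on hx (fun y hy z hz => ?_) ?_
    · obtain ⟨f, hf, hfn⟩ := ih hy
      obtain ⟨g, hg⟩ := proj_surjective z.unop
      refine ⟨g * f, by rw [map_mul, hf, hg]; rfl, ?_⟩
      rw [add_comm]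
      refine IsDeep.mul (isDeep_one fun i => ?_) hfn
      rw [← aug_proj, hg, hI z hz i]
    · rintro y z ⟨f, hf, hfn⟩ ⟨g, hg, hgn⟩
      exact ⟨f + g, by rw [map_add, hf, hg, MulOpposite.unop_add], hfn.add hgn⟩

lemma proj_eq_zero_of_isDeep {N : ℕ}
    (hN : ∀ ⦃i j : V⦄ (p : Path i j), AvoidsRelations R p → p.length < N)
    {f : PathAlgebra k V} (hf : IsDeep N f) : proj k R f = 0 := by
  rw [← map_zero (proj k R), proj_eq_proj_iff]
  exact fun i j p hp => hf p (hN p hp)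

variable (k) in
/-- The vertices of a quiver with relations, as a system of vertices of its algebra. -/
def vertexSystem (h : ∃ N : ℕ, ∀ ⦃i j : V⦄ (p : Path i j), AvoidsRelations R p → p.length < N) :
    VertexSystem (BoundAlgebra k R) k V where
  e := vertexIdempotent k R
  orthogonalIdempotents := orthogonalIdempotents_vertexIdempotent k R
  aug i := (aug k R i).fromOpposite fun _ _ => Commute.all _ _
  aug_self i := (aug_vertexIdempotent (R := R) i i).trans (if_pos rfl)
  aug_ne hij := (aug_vertexIdempotent (R := R) _ _).trans (if_neg hij)
  aug_surjective i c := by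
    refine ⟨MulOpposite.op (proj k R (block k i i (Finsupp.single Path.nil c))), ?_⟩
    change block k i i (Finsupp.single Path.nil c) i i Path.nil = c
    rw [block_same, Finsupp.single_eq_same]
  isNilpotent_iInf_ker := by
    obtain ⟨N, hN⟩ := h
    refine ⟨N, (Submodule.eq_bot_iff _).2 fun x hx => ?_⟩
    obtain ⟨f, hf, hfN⟩ := exists_isDeep_of_mem_pow (fun y hy i => (Submodule.mem_iInf _).1 hy i) hx
    exact MulOpposite.unop_injective (hf.symm.trans (proj_eq_zero_of_isDeep hN hfN))

end BoundAlgebra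

end PathAlgebra

section Shortcut

variable {k : Type u} [Field k] {V : Type u} [Quiver.{u} V] [DecidableEq V]
  {R : QuadraticRelations V} {J : Finset V}

open Quiver PathAlgebra BoundAlgebra

/-- The linear extension of `flatten`. -/
def flattenAlgebra (f : PathAlgebra k (Shortcut R J)) : PathAlgebra k V := fun x y =>
  if h : x ∈ J ∧ y ∈ J then
    (f ⟨x, h.1⟩ ⟨y, h.2⟩).mapDomain (flatten (i := ⟨x, h.1⟩) (j := ⟨y, h.2⟩))
  else 0

lemma flattenAlgebra_apply (f : PathAlgebra k (Shortcut R J)) (i j : Shortcut R J) :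
    flattenAlgebra f i.1 j.1 = (f i j).mapDomain flatten :=
  dif_pos ⟨i.2, j.2⟩

lemma flattenAlgebra_apply_flatten (f : PathAlgebra k (Shortcut R J)) {i j : Shortcut R J}
    (p : Path i j) : flattenAlgebra f i.1 j.1 (flatten p) = f i j p := by
  rw [flattenAlgebra_apply, Finsupp.mapDomain_apply flatten_injective]

lemma flattenAlgebra_of_notMem (f : PathAlgebra k (Shortcut R J)) {x y : V}
    (h : ¬ (x ∈ J ∧ y ∈ J)) : flattenAlgebra f x y = 0 :=
  dif_neg h

variable (R J) in
omit [DecidableEq V] in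
lemma exists_shortcut_or_notMem (x y : V) :
    (∃ i j : Shortcut R J, i.1 = x ∧ j.1 = y) ∨ ¬ (x ∈ J ∧ y ∈ J) :=
  or_iff_not_imp_right.2 fun h =>
    ⟨⟨x, (not_not.1 h).1⟩, ⟨y, (not_not.1 h).2⟩, rfl, rfl⟩

variable [Fintype V]

lemma flattenAlgebra_add (f g : PathAlgebra k (Shortcut R J)) :
    flattenAlgebra (f + g) = flattenAlgebra f + flattenAlgebra g := by
  funext x y
  rw [PathAlgebra.add_apply]
  obtain ⟨i, j, rfl, rfl⟩ | h := exists_shortcut_or_notMem R J x y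
  · simp only [flattenAlgebra_apply, PathAlgebra.add_apply, Finsupp.mapDomain_add]
  · simp only [flattenAlgebra_of_notMem _ h, add_zero]

lemma flattenAlgebra_mul (f g : PathAlgebra k (Shortcut R J)) :
    flattenAlgebra (f * g) = flattenAlgebra f * flattenAlgebra g := by
  funext x y
  rw [PathAlgebra.mul_apply]
  obtain ⟨i, j, rfl, rfl⟩ | h := exists_shortcut_or_notMem R J x y
  · have hconcat (l : Shortcut R J) : (concat k i l j (f i l) (g l j)).mapDomain flatten =
        concat k i.1 l.1 j.1 (flattenAlgebra f i.1 l.1) (flattenAlgebra g l.1 j.1) := by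
      rw [flattenAlgebra_apply f i l, flattenAlgebra_apply g l j, concat_mapDomain_flatten]
    have hsum : (∑ l : Shortcut R J, concat k i l j (f i l) (g l j)).mapDomain flatten =
        ∑ l ∈ J, concat k i.1 l j.1 (flattenAlgebra f i.1 l) (flattenAlgebra g l j.1) := by
      rw [Finsupp.mapDomain_finsetSum]
      exact (Fintype.sum_congr _ _ hconcat).trans (Finset.sum_coe_sort J fun l =>
        concat k i.1 l j.1 (flattenAlgebra f i.1 l) (flattenAlgebra g l j.1))
    rw [flattenAlgebra_apply, PathAlgebra.mul_apply, hsum]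
    refine Finset.sum_subset (Finset.subset_univ J) fun l _ hl => ?_
    rw [flattenAlgebra_of_notMem f fun h => hl h.2, map_zero, LinearMap.zero_apply]
  · rw [flattenAlgebra_of_notMem _ h, eq_comm]
    refine Finset.sum_eq_zero fun l _ => ?_
    by_cases hx : x ∈ J
    · rw [flattenAlgebra_of_notMem g fun h' => h ⟨hx, h'.2⟩, map_zero]
    · rw [flattenAlgebra_of_notMem f fun h' => hx h'.1, map_zero, LinearMap.zero_apply]

lemma proj_flattenAlgebra_eq_iff {f g : PathAlgebra k (Shortcut R J)} :
    proj k R (flattenAlgebra f) = proj k R (flattenAlgebra g) ↔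
      proj k (shortcutRelations R J) f = proj k (shortcutRelations R J) g := by
  rw [proj_eq_proj_iff, proj_eq_proj_iff]
  constructor
  · intro h i j p hp
    have hflat := h (flatten p) ((avoidsRelations_flatten_iff p).2 hp)
    rwa [flattenAlgebra_apply_flatten, flattenAlgebra_apply_flatten] at hflat
  · intro h x y p hp
    obtain ⟨i, j, rfl, rfl⟩ | hxy := exists_shortcut_or_notMem R J x y
    · obtain ⟨q, rfl⟩ := exists_flatten_eq p hp
      rw [flattenAlgebra_apply_flatten, flattenAlgebra_apply_flatten]
      exact h q ((avoidsRelations_flatten_iff q).1 hp)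
    · rw [flattenAlgebra_of_notMem f hxy, flattenAlgebra_of_notMem g hxy]

variable (k R J) in
/-- The embedding of the algebra of the shortcut quiver induced by `flattenAlgebra`. It preserves
the unit only up to the idempotent of `J`. -/
def shortcutHom : BoundAlgebra k (shortcutRelations R J) →ₙ+* BoundAlgebra k R where
  toFun := Quotient.lift (fun f => proj k R (flattenAlgebra f)) fun _ _ h =>
    proj_flattenAlgebra_eq_iff.2 ((RingCon.eq _).2 h)
  map_zero' := by
    refine (congrArg (proj k R) ?_).trans (map_zero (proj k R))
    simpa using flattenAlgebra_add (0 : PathAlgebra k (Shortcut R J)) 0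
  map_add' := by
    rintro ⟨f⟩ ⟨g⟩
    exact (congrArg (proj k R) (flattenAlgebra_add f g)).trans (map_add _ _ _)
  map_mul' := by
    rintro ⟨f⟩ ⟨g⟩
    exact (congrArg (proj k R) (flattenAlgebra_mul f g)).trans (map_mul _ _ _)

lemma shortcutHom_proj (f : PathAlgebra k (Shortcut R J)) :
    shortcutHom k R J (proj k (shortcutRelations R J) f) = proj k R (flattenAlgebra f) := rfl

lemma shortcutHom_injective : Function.Injective (shortcutHom k R J) := by
  intro b c h
  obtain ⟨f, rfl⟩ := proj_surjective b
  obtain ⟨g, rfl⟩ := proj_surjective c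
  exact proj_flattenAlgebra_eq_iff.1 h

lemma sum_vertexIdempotent_mul_eq_iff (f : PathAlgebra k V) :
    (∑ j ∈ J, vertexIdempotent k R j) * proj k R f = proj k R f ↔
      ∀ ⦃x y : V⦄ (p : Path x y), AvoidsRelations R p → x ∉ J → f x y p = 0 := by
  have h : (∑ j ∈ J, vertexIdempotent k R j) * proj k R f =
      proj k R (∑ j ∈ J, ofPath k (Path.nil : Path j j) * f) := by
    rw [Finset.sum_mul, map_sum]
    exact Finset.sum_congr rfl fun j _ => (map_mul _ _ _).symm
  rw [h, proj_eq_proj_iff]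
  refine forall_congr' fun x => forall_congr' fun y => forall₂_congr fun p hp => ?_
  simp only [PathAlgebra.sum_apply, ofPath_nil_mul_apply, Finset.sum_ite_eq]
  split_ifs with hx
  · simp [hx]
  · simp [hx, eq_comm]

lemma mul_sum_vertexIdempotent_eq_iff (f : PathAlgebra k V) :
    proj k R f * (∑ j ∈ J, vertexIdempotent k R j) = proj k R f ↔
      ∀ ⦃x y : V⦄ (p : Path x y), AvoidsRelations R p → y ∉ J → f x y p = 0 := by
  have h : proj k R f * (∑ j ∈ J, vertexIdempotent k R j) =
      proj k R (∑ j ∈ J, f * ofPath k (Path.nil : Path j j)) := by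
    rw [Finset.mul_sum, map_sum]
    exact Finset.sum_congr rfl fun j _ => (map_mul _ _ _).symm
  rw [h, proj_eq_proj_iff]
  refine forall_congr' fun x => forall_congr' fun y => forall₂_congr fun p hp => ?_
  simp only [PathAlgebra.sum_apply, mul_ofPath_nil_apply, Finset.sum_ite_eq]
  split_ifs with hy
  · simp [hy]
  · simp [hy, eq_comm]

lemma proj_mem_corner_iff (f : PathAlgebra k V) :
    proj k R f ∈ Subsemigroup.corner (∑ j ∈ J, vertexIdempotent k R j) ↔
      ∀ ⦃x y : V⦄ (p : Path x y), AvoidsRelations R p → ¬ (x ∈ J ∧ y ∈ J) → f x y p = 0 := by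
  rw [Subsemigroup.mem_corner_iff
      (orthogonalIdempotents_vertexIdempotent k R).isIdempotentElem_sum,
    sum_vertexIdempotent_mul_eq_iff, mul_sum_vertexIdempotent_eq_iff]
  simp only [not_and_or, or_imp, forall_and]

lemma shortcutHom_mem_corner (b : BoundAlgebra k (shortcutRelations R J)) :
    shortcutHom k R J b ∈ Subsemigroup.corner (∑ j ∈ J, vertexIdempotent k R j) := by
  obtain ⟨f, rfl⟩ := proj_surjective b
  refine (proj_mem_corner_iff _).2 fun x y p _ h => ?_
  rw [flattenAlgebra_of_notMem f h, Finsupp.zero_apply]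

lemma exists_shortcutHom_eq {a : BoundAlgebra k R}
    (ha : a ∈ Subsemigroup.corner (∑ j ∈ J, vertexIdempotent k R j)) :
    ∃ b, shortcutHom k R J b = a := by
  obtain ⟨f, rfl⟩ := proj_surjective a
  rw [proj_mem_corner_iff] at ha
  let g : PathAlgebra k (Shortcut R J) := fun i j =>
    (f i.1 j.1).comapDomain flatten flatten_injective.injOn
  refine ⟨proj k _ g, ?_⟩
  rw [shortcutHom_proj, proj_eq_proj_iff]
  intro x y p hp
  obtain ⟨i, j, rfl, rfl⟩ | hxy := exists_shortcut_or_notMem R J x y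
  · obtain ⟨q, rfl⟩ := exists_flatten_eq p hp
    rw [flattenAlgebra_apply_flatten]
    rfl
  · rw [flattenAlgebra_of_notMem g hxy, ha p hp hxy, Finsupp.zero_apply]

/-- The algebra of the shortcut quiver is the corner of the algebra of the given quiver at the
idempotent of `J`. -/
def shortcutEquivCorner (he : IsIdempotentElem (∑ j ∈ J, vertexIdempotent k R j)) :
    BoundAlgebra k (shortcutRelations R J) ≃+* he.Corner :=
  RingEquiv.ofBijective
    ({  toFun b := ⟨shortcutHom k R J b, shortcutHom_mem_corner b⟩
        map_zero' := Subtype.ext (map_zero _)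
        map_add' _ _ := Subtype.ext (map_add _ _ _)
        map_mul' _ _ := Subtype.ext (map_mul _ _ _) } :
      BoundAlgebra k (shortcutRelations R J) →ₙ+* he.Corner)
    ⟨fun _ _ h => shortcutHom_injective (congrArg Subtype.val h), fun a =>
      (exists_shortcutHom_eq a.2).imp fun _ => Subtype.ext⟩

end Shortcut

end GentleSilting

end

theorem theorem4p5_general (k : Type u) [Field k] {V : Type u} [Fintype V] [DecidableEq V]
    [Quiver.{u} V] (R : GentleSilting.QuadraticRelations V)
    (hR : ∃ N : ℕ, ∀ ⦃i j : V⦄ (p : Quiver.Path i j),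
      GentleSilting.AvoidsRelations R p → p.length < N)
    (J : Finset V) :
    GentleSilting.AreIsomorphic
      (GentleSilting.siltingComplex
        (GentleSilting.BoundAlgebra k (GentleSilting.shortcutRelations R J)))
      (GentleSilting.inducedSubcomplex
        (GentleSilting.siltingComplex (GentleSilting.BoundAlgebra k R))
        {v | v.gVector ∈ GentleSilting.coordinateSubspace (GentleSilting.vertexIdempotent k R)
          (GentleSilting.isIdempotentElem_vertexIdempotent k R) J}) :=
  (GentleSilting.BoundAlgebra.vertexSystem k hR).areIsomorphic_siltingComplex J
    (GentleSilting.shortcutEquivCorner _)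

/-- For a gentle quiver with relations and any subset `J` of its vertices, the 2-term silting
complex of the shortcut quiver at `J` is isomorphic to the subcomplex of the 2-term silting complex
of the given quiver which is induced by the indecomposable rigid 2-term objects whose g-vectors lie
in the coordinate subspace spanned by `J`. -/
theorem theorem4p5 (k : Type u) [Field k] {V : Type u} [Fintype V] [DecidableEq V]
    [Quiver.{u} V] (R : GentleSilting.QuadraticRelations V) (hR : GentleSilting.IsGentle R)
    (J : Finset V) :
    GentleSilting.AreIsomorphic
      (GentleSilting.siltingComplex
        (GentleSilting.BoundAlgebra k (GentleSilting.shortcutRelations R J)))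
      (GentleSilting.inducedSubcomplex
        (GentleSilting.siltingComplex (GentleSilting.BoundAlgebra k R))
        {v | v.gVector ∈ GentleSilting.coordinateSubspace (GentleSilting.vertexIdempotent k R)
          (GentleSilting.isIdempotentElem_vertexIdempotent k R) J}) :=
  theorem4p5_general k R hR.admissible J
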